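/- **Conventions.** A geodesic is an isometric embedding of an interval of $\mathbb{R}$, and a $\mathrm{CAT}(0)$ space is a geodesic metric space, here non-empty, in which distances between points of any geodesic triangle are at most the corresponding distances in a Euclidean comparison triangle. An action is *geometric* if it is isometric, properly discontinuous and cocompact. A map $f$ of metric spaces is a *$(\lambda,\epsilon)$-quasi-isometric embedding* ($\lambda\ge 1$, $\epsilon\ge 0$) if $\frac1\lambda d(a,b)-\epsilon\le d(f(a),f(b))\le\lambda\, d(a,b)+\epsilon$ for all $a,b$; a *$(\lambda,\epsilon)$-quasigeodesic* is such an embedding of an interval $[0,a]$ (not necessarily continuous). A *flat* in $X$ is the image of an isometric embedding of $\mathbb{E}^k$ for some $k\ge 2$. $\mathcal N_k(C)$ denotes the $k$-neighbourhood of $C$. A $\mathrm{CAT}(0)$ space $X$ has *isolated flats* if there is a family $\mathcal F$ of flats of $X$ such that: (1) there is a constant $B$ such that every flat of $X$ is contained in $\mathcal N_B(F')$ for some $F'\in\mathcal F$; (2) there is a function $\psi:[0,\infty)\to[0,\infty)$ such that $\mathcal N_k(F_1)\cap\mathcal N_k(F_2)$ has diameter at most $\psi(k)$ for all distinct $F_1,F_2\in\mathcal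 F$ and all $k\ge 0$; (3) $\mathcal F$ is invariant under $\mathrm{Isom}(X)$. Paths $\alpha:[0,a]\to X$ and $\alpha':[0,a']\to X$ *$L$-fellow travel relative to flats* if there are flats $F_1,\dots,F_n$ ($n\ge 0$) and partitions $0=t_0\le s_0\le t_1\le s_1\le\dots\le t_n\le s_n=a$ and $0=t_0'\le s_0'\le t_1'\le s_1'\le\dots\le t_n'\le s_n'=a'$ such that for $0\le i\le n$ the sets $\alpha([t_i,s_i])$ and $\alpha'([t_i',s_i'])$ are at Hausdorff distance at most $L$, and for $1\le i\le n$ the sets $\alpha([s_{i-1},t_i])$ and $\alpha'([s_{i-1}',t_i'])$ lie in $\mathcal N_L(F_i)$. The space $X$ has the *Relative Fellow Traveller Property* if for all $\lambda\ge 1$, $\epsilon\ge 0$ there is $L$ such that any two $(\lambda,\epsilon)$-quasigeodesics in $X$ with common endpoints $L$-fellow travel relative to flats. A subspace $Y\subseteq X$ is *quasiconvex* if for some $\nu\ge 0$ every geodesic of $X$ joining two points of $Y$ lies in $\mathcal N_\nu(Y)$. Given a geometric action of $G$ on $X$, a subgroup $H\le G$ is *quasiconvex* with respect to the action if the orbit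 $Hx_0$ is a quasiconvex subspace for some $x_0\in X$. **Theorem (Quasiconvex $\Leftrightarrow$ undistorted).** Let $\rho$ be a geometric action of a group $G$ on a $\mathrm{CAT}(0)$ space $X$ with isolated flats and the Relative Fellow Traveller Property, and let $H\le G$ be a finitely generated subgroup. Then $G$ is finitely generated and, for all finite generating sets $S$ of $G$ and $T$ of $H$, the subgroup $H$ is quasiconvex with respect to $\rho$ if and only if the inclusion $H\hookrightarrow G$ is a $(\lambda,\epsilon)$-quasi-isometric embedding, for some $\lambda\ge 1$ and $\epsilon\ge 0$, for the word metrics of $T$ and $S$. In particular, if $\rho'$ is another geometric action of $G$ on a $\mathrm{CAT}(0)$ space with isolated flats and the Relative Fellow Traveller Property, then $H$ is quasiconvex with respect to $\rho$ if and only if it is quasiconvex with respect to $\rho'$. -/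

import Mathlib

/-- `f` is a `(lam, ε)`-quasi-isometric embedding with respect to the distance functions
`dA` and `dB`. -/
def IsQuasiIsometricEmbedding {A B : Type*} (dA : A → A → ℝ) (dB : B → B → ℝ)
    (lam ε : ℝ) (f : A → B) : Prop :=
  ∀ a b : A, 1 / lam * dA a b - ε ≤ dB (f a) (f b) ∧ dB (f a) (f b) ≤ lam * dA a b + ε

/-- The word length of `g` with respect to `S`: the least length of a word in `S ∪ S⁻¹`
representing `g`. It is only used when `S` generates the group. -/
noncomputable def wordLength {G : Type*} [Group G] (S : Set G) (g : G) : ℕ :=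
  sInf {n : ℕ | ∃ l : List G, l.length = n ∧ (∀ x ∈ l, x ∈ S ∨ x⁻¹ ∈ S) ∧ l.prod = g}

/-- The word metric of a group with respect to a generating set `S`. -/
noncomputable def wordDist {G : Type*} [Group G] (S : Set G) (g h : G) : ℝ :=
  (wordLength S (g⁻¹ * h) : ℝ)

/-- `S` is a finite generating set of `G`. -/
def IsFiniteGeneratingSet {G : Type*} [Group G] (S : Set G) : Prop :=
  S.Finite ∧ Subgroup.closure S = ⊤

/-- The inclusion `H → G` is a quasi-isometric embedding, where `H` and `G` carry the word metrics
of the generating sets `T` and `S`. -/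
def InclusionIsQuasiIsometricEmbedding {G : Type*} [Group G] (H : Subgroup G)
    (T : Set H) (S : Set G) : Prop :=
  ∃ lam ε : ℝ, 1 ≤ lam ∧ 0 ≤ ε ∧
    IsQuasiIsometricEmbedding (wordDist T) (wordDist S) lam ε (fun h : H => (h : G))

/-- The restriction of `γ` to `[0, l]` is a geodesic from `x` to `y` (so that `l = dist x y`). -/
def IsGeodesicSegment {X : Type*} [MetricSpace X] (γ : ℝ → X) (l : ℝ) (x y : X) : Prop :=
  0 ≤ l ∧ γ 0 = x ∧ γ l = y ∧
    ∀ s ∈ Set.Icc 0 l, ∀ t ∈ Set.Icc 0 l, dist (γ s) (γ t) = |s - t|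

/-- A `CAT(0)` space: a geodesic space in which distances between points on the sides of a geodesic
triangle are at most the distances between the corresponding points of a comparison triangle in the
Euclidean plane. The two sides carrying the points are `[p, q]` and `[p, r]`; as the vertices and
the sides are arbitrary, this covers any two sides of any geodesic triangle. -/
def IsCATZero (X : Type*) [MetricSpace X] : Prop :=
  (∀ x y : X, ∃ (γ : ℝ → X) (l : ℝ), IsGeodesicSegment γ l x y) ∧
  ∀ (p q r : X) (γ γ' : ℝ → X) (l l' : ℝ),
    IsGeodesicSegment γ l p q → IsGeodesicSegment γ' l' p r →
    ∀ p₀ q₀ r₀ : EuclideanSpace ℝ (Fin 2),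
      dist p₀ q₀ = dist p q → dist p₀ r₀ = dist p r → dist q₀ r₀ = dist q r →
      ∀ s ∈ Set.Icc 0 l, ∀ t ∈ Set.Icc 0 l',
      ∀ x₀ ∈ segment ℝ p₀ q₀, ∀ y₀ ∈ segment ℝ p₀ r₀,
        dist p₀ x₀ = dist p (γ s) → dist p₀ y₀ = dist p (γ' t) →
        dist (γ s) (γ' t) ≤ dist x₀ y₀

/-- A geometric action: isometric, properly discontinuous, and cocompact. -/
structure IsGeometricAction (G X : Type*) [Group G] [MetricSpace X] [MulAction G X] : Prop where
  isometric : IsIsometricSMul G X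
  properlyDiscontinuous : ProperlyDiscontinuousSMul G X
  cocompact : ∃ K : Set X, IsCompact K ∧ ⋃ g : G, (fun x => g • x) '' K = Set.univ

/-- A flat, regarded as a subspace: the image of an isometric embedding of a Euclidean space of
dimension at least two. -/
def IsFlat {X : Type*} [MetricSpace X] (F : Set X) : Prop :=
  ∃ (k : ℕ) (f : EuclideanSpace ℝ (Fin k) → X), 2 ≤ k ∧ Isometry f ∧ Set.range f = F

/-- The isolated flats property. -/
def HasIsolatedFlats (X : Type*) [MetricSpace X] : Prop :=
  ∃ 𝓕 : Set (Set X), (∀ F ∈ 𝓕, IsFlat F) ∧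
    (∃ B : ℝ, ∀ F : Set X, IsFlat F → ∃ F' ∈ 𝓕, F ⊆ Metric.cthickening B F') ∧
    (∃ ψ : ℝ → ℝ, ∀ F₁ ∈ 𝓕, ∀ F₂ ∈ 𝓕, F₁ ≠ F₂ → ∀ k : ℝ, 0 ≤ k →
      ∀ x ∈ Metric.cthickening k F₁ ∩ Metric.cthickening k F₂,
      ∀ y ∈ Metric.cthickening k F₁ ∩ Metric.cthickening k F₂, dist x y ≤ ψ k) ∧
    ∀ g : X ≃ᵢ X, ∀ F ∈ 𝓕, g '' F ∈ 𝓕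

/-- The restriction of `α` to `[0, a]` is a `(lam, ε)`-quasigeodesic. -/
def IsQuasigeodesic {X : Type*} [MetricSpace X] (lam ε : ℝ) (α : ℝ → X) (a : ℝ) : Prop :=
  0 ≤ a ∧ IsQuasiIsometricEmbedding (A := Set.Icc 0 a) dist dist lam ε (fun t => α t)

/-- The paths `α` on `[0, a]` and `α'` on `[0, a']` `L`-fellow travel relative to the sequence of
flats `F 0, …, F (n - 1)`. Only the values `t i`, `s i`, `t' i`, `s' i` with `i ≤ n` matter. -/
def FellowTravelRelativeTo {X : Type*} [MetricSpace X] (L : ℝ) (α : ℝ → X) (a : ℝ)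
    (α' : ℝ → X) (a' : ℝ) {n : ℕ} (F : Fin n → Set X) : Prop :=
  ∃ t s t' s' : ℕ → ℝ,
    (t 0 = 0 ∧ s n = a ∧ (∀ i ≤ n, t i ≤ s i) ∧ ∀ i < n, s i ≤ t (i + 1)) ∧
    (t' 0 = 0 ∧ s' n = a' ∧ (∀ i ≤ n, t' i ≤ s' i) ∧ ∀ i < n, s' i ≤ t' (i + 1)) ∧
    (∀ i ≤ n, Metric.hausdorffEDist (α '' Set.Icc (t i) (s i)) (α' '' Set.Icc (t' i) (s' i))
      ≤ ENNReal.ofReal L) ∧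
    ∀ i : Fin n, α '' Set.Icc (s i) (t (i + 1)) ⊆ Metric.cthickening L (F i) ∧
      α' '' Set.Icc (s' i) (t' (i + 1)) ⊆ Metric.cthickening L (F i)

/-- The Relative Fellow Traveller Property. -/
def HasRelativeFellowTravellerProperty (X : Type*) [MetricSpace X] : Prop :=
  ∀ lam ε : ℝ, 1 ≤ lam → 0 ≤ ε → ∃ L : ℝ, 0 ≤ L ∧
    ∀ (α : ℝ → X) (a : ℝ) (α' : ℝ → X) (a' : ℝ),
      IsQuasigeodesic lam ε α a → IsQuasigeodesic lam ε α' a' →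
      α 0 = α' 0 → α a = α' a' →
      ∃ (n : ℕ) (F : Fin n → Set X), (∀ i, IsFlat (F i)) ∧ FellowTravelRelativeTo L α a α' a' F

/-- A quasiconvex subspace: for some `ν ≥ 0`, every geodesic joining two points of `Y` lies in the
`ν`-neighbourhood of `Y`. -/
def IsQuasiconvexSubspace {X : Type*} [MetricSpace X] (Y : Set X) : Prop :=
  ∃ ν : ℝ, 0 ≤ ν ∧ ∀ x ∈ Y, ∀ y ∈ Y, ∀ (γ : ℝ → X) (l : ℝ), IsGeodesicSegment γ l x y →
    ∀ t ∈ Set.Icc 0 l, γ t ∈ Metric.cthickening ν Y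

/-- `H` is quasiconvex with respect to the given action of `G` on `X`. -/
def IsQuasiconvexSubgroup {G : Type*} [Group G] (H : Subgroup G) (X : Type*) [MetricSpace X]
    [MulAction G X] : Prop :=
  ∃ x₀ : X, IsQuasiconvexSubspace (MulAction.orbit H x₀)

/-! If an orbit of `H` is quasiconvex, the Milnor–Švarc argument runs inside it: a geodesic from `x`
to `h • x` is shadowed by orbit points with uniformly short steps, and only finitely many elements
of `H` move `x` a short distance. Hence word length in `H` is bounded linearly by displacement,
which word length in `G` bounds linearly in turn. The cocompact case of the same argument shows that
`G` is finitely generated.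

Conversely, if `H` is undistorted, a geodesic word of `H` traces a quasigeodesic in the orbit, and
the Relative Fellow Traveller Property compares it with the CAT(0) geodesic `γ` between the same
endpoints. Outside the flats, `γ` is close to the orbit at once. Along a flat, only the ends of the
corresponding piece of `γ` are known to be close to it. Convexity of the metric replaces that piece
by a geodesic of a flat `F` of the isolated family whose ends are close to the orbit, so it must be
shown that such a geodesic stays close to the orbit.

This last point is Euclidean. Isolation makes the family of flats locally finite, so by pigeonhole
the stabilizer of `F` acts coboundedly on `F`, and an orbit point of `H` near `F` is near an orbit
point of the stabilizer of `F` in `H`. By Bieberbach's theorem the discrete cobounded group acting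
on `F` has finitely many linear parts. So each of its subgroups is, up to finitely many
representatives, a group of translations, whose orbits are quasiconvex
(`exists_orbit_zero_quasiconvex`). Finitely many flats up to translation by `H` give a uniform
constant. -/

theorem Set.Finite.of_separated_image {ι M : Type*} [PseudoMetricSpace M] {s : Set ι} {f : ι → M}
    {K : Set M} (hK : IsCompact K) (hf : ∀ x ∈ s, f x ∈ K) {δ : ℝ} (hδ : 0 < δ)
    (hsep : ∀ x ∈ s, ∀ y ∈ s, dist (f x) (f y) < δ → x = y) : s.Finite := by
  obtain ⟨t, -, htf, hcov⟩ := hK.finite_cover_balls (half_pos hδ)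
  have hc : ∀ x, ∃ c, x ∈ s → c ∈ t ∧ dist (f x) c < δ / 2 := by
    intro x
    by_cases hx : x ∈ s
    · obtain ⟨c, hc, hxc⟩ := Set.mem_iUnion₂.1 (hcov (hf x hx))
      exact ⟨c, fun _ => ⟨hc, hxc⟩⟩
    · exact ⟨f x, fun h => absurd h hx⟩
  choose c hc using hc
  refine Set.Finite.of_finite_image (f := c) (htf.subset ?_) ?_
  · rintro _ ⟨x, hx, rfl⟩
    exact (hc x hx).1
  · intro x hx y hy hxy
    refine hsep x hx y hy ?_
    have h1 := (hc x hx).2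
    have h2 := (hc y hy).2
    rw [← hxy] at h2
    have := dist_triangle_right (f x) (f y) (c x)
    linarith

theorem Set.Finite.exists_finite_representatives {ι κ : Type*} {s : Set ι} {g : ι → κ}
    (h : (g '' s).Finite) : ∃ t ⊆ s, t.Finite ∧ ∀ x ∈ s, ∃ y ∈ t, g y = g x := by
  obtain ⟨t, hts, hb⟩ := Set.exists_subset_bijOn s g
  refine ⟨t, hts, ?_, fun x hx => hb.surjOn (Set.mem_image_of_mem g hx)⟩
  exact Set.Finite.of_finite_image (hb.image_eq ▸ h) hb.injOn

theorem Set.Finite.exists_nonneg_upper_bound {ι : Type*} {s : Set ι} (hs : s.Finite) (f : ι → ℝ) :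
    ∃ C : ℝ, 0 ≤ C ∧ ∀ x ∈ s, f x ≤ C := by
  obtain ⟨C, hC⟩ := (hs.image f).bddAbove
  exact ⟨max C 0, le_max_right _ _, fun x hx => (hC ⟨x, hx, rfl⟩).trans (le_max_left _ _)⟩

/-! ### Discrete cobounded groups of Euclidean isometries. -/

section Bieberbach

variable {E : Type*} [NormedAddCommGroup E] [InnerProductSpace ℝ E]

/-- The linear part of an affine isometry. -/
noncomputable def linPart (φ : E ≃ᵃⁱ[ℝ] E) : E →L[ℝ] E :=
  (φ.linearIsometryEquiv.toContinuousLinearEquiv : E →L[ℝ] E)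

theorem linPart_apply (φ : E ≃ᵃⁱ[ℝ] E) (x : E) : linPart φ x = φ x - φ 0 := by
  have := φ.map_vsub x 0
  simpa [linPart] using this

theorem apply_eq_linPart_add (φ : E ≃ᵃⁱ[ℝ] E) (x : E) : φ x = linPart φ x + φ 0 := by
  simp [linPart_apply]

theorem norm_linPart_apply (φ : E ≃ᵃⁱ[ℝ] E) (x : E) : ‖linPart φ x‖ = ‖x‖ := by
  simp [linPart]

theorem norm_linPart_le (φ : E ≃ᵃⁱ[ℝ] E) : ‖linPart φ‖ ≤ 1 :=
  ContinuousLinearMap.opNorm_le_bound _ zero_le_one fun x => by rw [norm_linPart_apply, one_mul]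

theorem linPart_mul (φ ψ : E ≃ᵃⁱ[ℝ] E) : linPart (φ * ψ) = linPart φ * linPart ψ := by
  ext x
  change _ = linPart φ (linPart ψ x)
  rw [linPart_apply, linPart_apply ψ, map_sub, linPart_apply φ, linPart_apply φ]
  simp

theorem linPart_one : linPart (1 : E ≃ᵃⁱ[ℝ] E) = 1 := by
  ext x
  simp [linPart_apply]

theorem linPart_mul_linPart_inv (φ : E ≃ᵃⁱ[ℝ] E) : linPart φ * linPart φ⁻¹ = 1 := by
  rw [← linPart_mul, mul_inv_cancel, linPart_one]

theorem norm_linPart_mul_inv_sub_one_le (φ ψ : E ≃ᵃⁱ[ℝ] E) :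
    ‖linPart (φ * ψ⁻¹) - 1‖ ≤ ‖linPart φ - linPart ψ‖ := by
  have h : linPart (φ * ψ⁻¹) - 1 = (linPart φ - linPart ψ) * linPart ψ⁻¹ := by
    rw [sub_mul, linPart_mul_linPart_inv, linPart_mul]
  rw [h]
  exact (norm_mul_le _ _).trans (mul_le_of_le_one_right (norm_nonneg _) (norm_linPart_le _))

/-- The identity `AB - BA = (A - 1)(B - 1) - (B - 1)(A - 1)` makes the bound quadratic: commutators
contract towards the identity. -/
theorem norm_linPart_commutator_sub_one_le (α β : E ≃ᵃⁱ[ℝ] E) :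
    ‖linPart (α * β * (β * α)⁻¹) - 1‖ ≤ 2 * ‖linPart α - 1‖ * ‖linPart β - 1‖ := by
  refine (norm_linPart_mul_inv_sub_one_le _ _).trans ?_
  have h : linPart (α * β) - linPart (β * α) =
      (linPart α - 1) * (linPart β - 1) - (linPart β - 1) * (linPart α - 1) := by
    rw [linPart_mul, linPart_mul]
    noncomm_ring
  rw [h]
  refine (norm_sub_le _ _).trans ?_
  have h1 := norm_mul_le (linPart α - 1) (linPart β - 1)
  have h2 := norm_mul_le (linPart β - 1) (linPart α - 1)
  linarith

/-- Evaluating `κβα = αβ` at `0` expresses the translation part of the commutator as `(A - 1)(β 0)`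
plus errors controlled by `K - 1` and `B - 1`, where `A`, `B`, `K` are the linear parts. -/
theorem norm_commutator_apply_zero_sub_le (α β : E ≃ᵃⁱ[ℝ] E) :
    ‖(α * β * (β * α)⁻¹) 0 - (linPart α - 1) (β 0)‖ ≤
      ‖linPart (α * β * (β * α)⁻¹) - 1‖ * ‖β 0‖ + ‖linPart β - 1‖ * ‖α 0‖ := by
  set κ := α * β * (β * α)⁻¹ with hκ
  have hmul : κ * (β * α) = α * β := by rw [hκ]; group
  have h0 : linPart κ (linPart β (α 0) + β 0) + κ 0 = linPart α (β 0) + α 0 := by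
    rw [← apply_eq_linPart_add, ← apply_eq_linPart_add, ← apply_eq_linPart_add]
    exact congrArg (fun φ : E ≃ᵃⁱ[ℝ] E => φ 0) hmul
  have hlin : linPart κ * (linPart β * linPart α) = linPart α * linPart β := by
    rw [← linPart_mul, ← linPart_mul, ← linPart_mul, hmul]
  set c := linPart α⁻¹ (α 0) with hc
  have hac : linPart α c = α 0 := by
    have := congrArg (fun T : E →L[ℝ] E => T (α 0)) (linPart_mul_linPart_inv α)
    simpa using this
  have hcn : ‖c‖ = ‖α 0‖ := norm_linPart_apply _ _
  have h1 : linPart κ (linPart β (α 0)) = linPart α (linPart β c) := by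
    rw [← hac]
    exact congrArg (fun T : E →L[ℝ] E => T c) hlin
  have h2 : κ 0 - (linPart α - 1) (β 0) =
      -(linPart κ - 1) (β 0) - linPart α ((linPart β - 1) c) := by
    have h3 : κ 0 = linPart α (β 0) + α 0 - linPart κ (linPart β (α 0) + β 0) := by
      rw [← h0]; abel
    rw [h3, map_add, h1, sub_apply, sub_apply,
      sub_apply, map_sub]
    simp only [one_apply_eq_self, hac]
    abel
  rw [h2]
  refine (norm_sub_le _ _).trans ?_
  rw [norm_neg, norm_linPart_apply, ← hcn]
  exact add_le_add (ContinuousLinearMap.le_opNorm _ _) (ContinuousLinearMap.le_opNorm _ _)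

theorem ContinuousLinearMap.exists_norm_apply_eq_opNorm [FiniteDimensional ℝ E] [Nontrivial E]
    (T : E →L[ℝ] E) : ∃ x : E, ‖x‖ = 1 ∧ ‖T x‖ = ‖T‖ := by
  have hne : (Metric.sphere (0 : E) 1).Nonempty := NormedSpace.sphere_nonempty.2 zero_le_one
  obtain ⟨x, hx, hmax⟩ := (isCompact_sphere (0 : E) 1).exists_isMaxOn hne
    (T.continuous.norm.continuousOn)
  have hx1 : ‖x‖ = 1 := by simpa using hx
  refine ⟨x, hx1, le_antisymm (by simpa [hx1] using T.le_opNorm x) ?_⟩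
  refine T.opNorm_le_of_unit_norm (norm_nonneg _) fun y hy => ?_
  exact hmax (by simpa using hy)

open ContinuousLinearMap in
/-- The eigenspace of `star N * N` for the eigenvalue `‖N‖ ^ 2`, on which `N` scales the norm by
exactly `‖N‖`, splits off from a normal operator `N` with a spectral gap. -/
theorem exists_top_singular_projection [FiniteDimensional ℝ E] (N : E →L[ℝ] E)
    (hN : star N * N = N * star N) (hN0 : N ≠ 0) :
    ∃ (P : E →L[ℝ] E) (q : ℝ), 0 ≤ q ∧ q < ‖N‖ ∧ (∀ x, ‖P x‖ ≤ ‖x‖) ∧ (∀ x, ‖x - P x‖ ≤ ‖x‖) ∧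
      (∀ x, ‖N (P x)‖ = ‖N‖ * ‖P x‖) ∧ (∀ x, ‖N (x - P x)‖ ≤ q * ‖x - P x‖) ∧
      (∀ x, P (N x) = N (P x)) ∧ ∃ u, ‖u‖ = 1 ∧ P u = u := by
  have hnt : Nontrivial E := by
    by_contra h
    rw [not_nontrivial_iff_subsingleton] at h
    exact hN0 (ext fun x => Subsingleton.elim _ _)
  set m := ‖N‖ with hm
  have hmpos : 0 < m := norm_pos_iff.2 hN0
  set V : Submodule ℝ E := LinearMap.ker ((star N * N - (m ^ 2) • 1 : E →L[ℝ] E) : E →ₗ[ℝ] E) with hV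
  have hmemV : ∀ x, x ∈ V ↔ star N (N x) = (m ^ 2) • x := by
    intro x
    simp [hV, LinearMap.mem_ker, sub_eq_zero]
  have hcomm : ∀ x, star N (N x) = N (star N x) := fun x => congrArg (fun T : E →L[ℝ] E => T x) hN
  have hinner : ∀ x y, inner ℝ (star N x) y = inner ℝ x (N y) := fun x y => by
    rw [star_eq_adjoint, adjoint_inner_left]
  have hVeq : ∀ x ∈ V, ‖N x‖ = m * ‖x‖ := by
    intro x hx
    have h1 : ‖N x‖ ^ 2 = (m * ‖x‖) ^ 2 := by
      rw [← real_inner_self_eq_norm_sq, ← hinner, (hmemV x).1 hx, real_inner_smul_left,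
        real_inner_self_eq_norm_sq]
      ring
    exact (pow_left_inj₀ (norm_nonneg _) (by positivity) two_ne_zero).1 h1
  -- Vectors on which `N` attains its norm lie in `V`: expanding `‖N*N x - m² x‖²` gives at most
  -- `2m⁴‖x‖² - 2m²‖N x‖² ≤ 0`.
  have hVof : ∀ x, m * ‖x‖ ≤ ‖N x‖ → x ∈ V := by
    intro x hx
    rw [hmemV, ← sub_eq_zero, ← norm_eq_zero]
    have hS : ‖star N (N x)‖ ≤ m ^ 2 * ‖x‖ := by
      calc ‖star N (N x)‖ ≤ ‖star N‖ * ‖N x‖ := le_opNorm _ _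
        _ ≤ m * (m * ‖x‖) := by
            rw [star_eq_adjoint, LinearIsometryEquiv.norm_map]
            exact mul_le_mul_of_nonneg_left (le_opNorm _ _) hmpos.le
        _ = _ := by ring
    have h2 : inner ℝ (star N (N x)) ((m ^ 2) • x) = m ^ 2 * ‖N x‖ ^ 2 := by
      rw [real_inner_smul_right, hinner, real_inner_self_eq_norm_sq]
    have h3 : ‖star N (N x) - (m ^ 2) • x‖ ^ 2 =
        ‖star N (N x)‖ ^ 2 - 2 * (m ^ 2 * ‖N x‖ ^ 2) + (m ^ 2 * ‖x‖) ^ 2 := by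
      rw [norm_sub_sq_real, h2, norm_smul, Real.norm_of_nonneg (by positivity)]
    have h4 : ‖star N (N x)‖ ^ 2 ≤ (m ^ 2 * ‖x‖) ^ 2 := by gcongr
    have h5 : (m * ‖x‖) ^ 2 ≤ ‖N x‖ ^ 2 := by gcongr
    have h6 : ‖star N (N x) - (m ^ 2) • x‖ ^ 2 ≤ 0 := by
      rw [h3]
      nlinarith [mul_le_mul_of_nonneg_left h5 (sq_nonneg m)]
    exact pow_eq_zero_iff two_ne_zero |>.1 (le_antisymm h6 (sq_nonneg _))
  -- Normality makes `V` invariant under both `N` and its adjoint, hence `Vᗮ` invariant under `N`,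
  -- so that `P` commutes with `N`.
  have hVN : ∀ x ∈ V, N x ∈ V := by
    intro x hx
    rw [hmemV, hcomm, hcomm, ← hcomm x, (hmemV x).1 hx, map_smul]
  have hVN' : ∀ x ∈ V, star N x ∈ V := by
    intro x hx
    rw [hmemV, ← hcomm, (hmemV x).1 hx, map_smul]
  set P := V.starProjection with hP
  have hPmem : ∀ x, P x ∈ V := fun x => V.starProjection_apply_mem x
  have hQmem : ∀ x, x - P x ∈ Vᗮ := fun x => V.sub_starProjection_mem_orthogonal x
  have hPid : ∀ x ∈ V, P x = x := fun x hx => Submodule.starProjection_eq_self_iff.2 hx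
  have hPz : ∀ x ∈ Vᗮ, P x = 0 := fun x hx =>
    (Submodule.starProjection_apply_eq_zero_iff V).2 hx
  have hVortho : ∀ x ∈ Vᗮ, N x ∈ Vᗮ := by
    intro x hx
    rw [Submodule.mem_orthogonal] at hx ⊢
    intro v hv
    rw [← hinner]
    exact hx _ (hVN' v hv)
  have hpyth : ∀ x, ‖x‖ ^ 2 = ‖P x‖ ^ 2 + ‖x - P x‖ ^ 2 := by
    intro x
    have h0 : inner ℝ (P x) (x - P x) = 0 := (Submodule.mem_orthogonal _ _).1 (hQmem x) _ (hPmem x)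
    have := norm_add_sq_real (P x) (x - P x)
    rw [h0, add_sub_cancel] at this
    linarith
  have hPle : ∀ x, ‖P x‖ ≤ ‖x‖ := fun x =>
    le_of_sq_le_sq (by nlinarith [hpyth x, sq_nonneg ‖x - P x‖]) (norm_nonneg _)
  have hQle : ∀ x, ‖x - P x‖ ≤ ‖x‖ := fun x =>
    le_of_sq_le_sq (by nlinarith [hpyth x, sq_nonneg ‖P x‖]) (norm_nonneg _)
  refine ⟨P, ‖N * (1 - P)‖, norm_nonneg _, ?_, hPle, hQle, fun x => hVeq _ (hPmem x), ?_, ?_, ?_⟩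
  -- The gap is strict because `N * (1 - P)` attains its norm on the unit sphere: a value of at
  -- least `m` there would put `x - P x` in `V ∩ Vᗮ = 0`.
  · obtain ⟨x, hx1, hx⟩ := (N * (1 - P)).exists_norm_apply_eq_opNorm
    have hx' : ‖N (x - P x)‖ = ‖N * (1 - P)‖ := by simpa using hx
    by_contra hlt
    rw [not_lt, ← hx'] at hlt
    have hV' : x - P x ∈ V := hVof _ <| le_trans
      (mul_le_of_le_one_right hmpos.le ((hQle x).trans hx1.le)) hlt
    have h0 : x - P x = 0 := by
      rw [← hPid _ hV', hPz _ (hQmem x)]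
    rw [h0, map_zero, norm_zero] at hlt
    linarith
  · intro x
    have h0 : (N * (1 - P)) (x - P x) = N (x - P x) := by
      simp [hPid _ (hPmem x)]
    rw [← h0]
    exact le_opNorm _ _
  · intro x
    have h0 : N x = N (P x) + N (x - P x) := by rw [← map_add, add_sub_cancel]
    rw [h0, map_add, hPid _ (hVN _ (hPmem x)), hPz _ (hVortho _ (hQmem x)), add_zero]
  · obtain ⟨u, hu1, hu⟩ := N.exists_norm_apply_eq_opNorm
    exact ⟨u, hu1, hPid u (hVof u (by rw [hu, hu1, mul_one]))⟩

variable {Γ : Subgroup (E ≃ᵃⁱ[ℝ] E)}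

theorem exists_min_norm_apply_zero (hdisc : ∀ R : ℝ, {φ | φ ∈ Γ ∧ ‖φ 0‖ ≤ R}.Finite)
    {W : Set (E ≃ᵃⁱ[ℝ] E)} (hW : W.Nonempty) (hWΓ : ∀ φ ∈ W, φ ∈ Γ) :
    ∃ φ ∈ W, ∀ ψ ∈ W, ‖φ 0‖ ≤ ‖ψ 0‖ := by
  obtain ⟨w, hw⟩ := hW
  have hfin : {φ | φ ∈ W ∧ ‖φ 0‖ ≤ ‖w 0‖}.Finite :=
    (hdisc ‖w 0‖).subset fun φ hφ => ⟨hWΓ φ hφ.1, hφ.2⟩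
  obtain ⟨φ, hφ, hmin⟩ := Set.exists_min_image _ (fun φ : E ≃ᵃⁱ[ℝ] E => ‖φ 0‖) hfin ⟨w, hw, le_rfl⟩
  refine ⟨φ, hφ.1, fun ψ hψ => ?_⟩
  rcases le_total ‖ψ 0‖ ‖w 0‖ with h | h
  · exact hmin ψ ⟨hψ, h⟩
  · exact hφ.2.trans h

/-- Choose group elements taking `0` near `k • u` for each `k`. Their linear parts lie in a compact
ball, so two of them nearly agree. The quotient of a far one by a fixed one has linear part near
`1`, and its displacement of `0` differs from a multiple of `u` by a bounded error. -/
theorem exists_mem_almost_translation [FiniteDimensional ℝ E] {C : ℝ}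
    (hcob : ∀ x : E, ∃ φ ∈ Γ, ‖φ 0 - x‖ ≤ C) {u : E} (hu : ‖u‖ = 1) {ε δ : ℝ} (hε : 0 < ε)
    (hδ : 0 < δ) :
    ∃ φ ∈ Γ, ‖linPart φ - 1‖ ≤ ε ∧ ∃ t : ℝ, 0 < t ∧ ‖φ 0 - t • u‖ ≤ δ * t := by
  choose β hβ hβu using fun k : ℕ => hcob ((k : ℝ) • u)
  obtain ⟨L, -, σ, hσ, hL⟩ := (isCompact_closedBall (0 : E →L[ℝ] E) 1).tendsto_subseq
    (x := fun k => linPart (β k)) (fun k => by simpa using norm_linPart_le (β k))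
  obtain ⟨n, hn⟩ := Metric.cauchySeq_iff.1 hL.cauchySeq ε hε
  obtain ⟨k, hk⟩ := exists_nat_ge ((2 * C + σ n) / δ)
  set j := σ (max n (k + 1)) with hj
  have hkj : k + 1 ≤ j := (le_max_right _ _).trans hσ.le_apply
  have hkj' : (k : ℝ) + 1 ≤ j := by exact_mod_cast hkj
  have hlin : ‖linPart (β j * (β (σ n))⁻¹) - 1‖ ≤ ε := by
    refine (norm_linPart_mul_inv_sub_one_le _ _).trans ?_
    rw [← dist_eq_norm]
    exact (hn _ (le_max_left _ _) n le_rfl).le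
  refine ⟨β j * (β (σ n))⁻¹, Γ.mul_mem (hβ _) (Γ.inv_mem (hβ _)), hlin, j,
    by linarith [k.cast_nonneg (α := ℝ)], ?_⟩
  set ψ := β j * (β (σ n))⁻¹ with hψ
  have h0 : β j 0 = linPart ψ (β (σ n) 0) + ψ 0 := by
    rw [← apply_eq_linPart_add]
    have : ψ * β (σ n) = β j := by rw [hψ]; group
    exact congrArg (fun φ : E ≃ᵃⁱ[ℝ] E => φ 0) this.symm
  have h1 : ‖β (σ n) 0‖ ≤ C + σ n := by
    have h2 := norm_le_norm_sub_add (β (σ n) 0) ((σ n : ℝ) • u)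
    rw [norm_smul, hu, mul_one, Real.norm_of_nonneg (Nat.cast_nonneg _)] at h2
    linarith [hβu (σ n)]
  calc ‖ψ 0 - (j : ℝ) • u‖ = ‖(β j 0 - (j : ℝ) • u) - linPart ψ (β (σ n) 0)‖ := by
        rw [h0]; congr 1; abel
    _ ≤ C + (C + σ n) := (norm_sub_le _ _).trans
        (add_le_add (hβu j) ((norm_linPart_apply _ _).trans_le h1))
    _ ≤ δ * k := by rw [div_le_iff₀ hδ] at hk; linarith
    _ ≤ δ * j := by gcongr; linarith

/-- In a discrete cocompact group of Euclidean isometries, an element whose linear part is close to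
the identity is a translation. -/
theorem linPart_eq_one_of_norm_sub_one_le [FiniteDimensional ℝ E]
    (hdisc : ∀ R : ℝ, {φ | φ ∈ Γ ∧ ‖φ 0‖ ≤ R}.Finite) {C : ℝ}
    (hcob : ∀ x : E, ∃ φ ∈ Γ, ‖φ 0 - x‖ ≤ C) {α₀ : E ≃ᵃⁱ[ℝ] E} (hα₀ : α₀ ∈ Γ)
    (hnorm : ‖linPart α₀ - 1‖ ≤ 1 / 2) : linPart α₀ = 1 := by
  by_contra hne
  -- Buser's argument: take a counterexample `α` of least displacement at `0`, then a least `β` that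
  -- is almost a translation along the top singular space of `A - 1`. The commutator of `α` and `β`
  -- will be of the same kind as `β` but shorter.
  obtain ⟨α, ⟨hα, hαn, hα1⟩, hαmin⟩ := exists_min_norm_apply_zero hdisc
    (W := {φ | φ ∈ Γ ∧ ‖linPart φ - 1‖ ≤ 1 / 2 ∧ linPart φ ≠ 1}) ⟨α₀, hα₀, hnorm, hne⟩
    fun φ hφ => hφ.1
  have hstar : star (linPart α) * linPart α = 1 := by
    ext x
    refine ext_inner_right ℝ fun y => ?_
    simp [linPart, ContinuousLinearMap.star_eq_adjoint]
  have hstar' : linPart α * star (linPart α) = 1 := by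
    have : star (linPart α) = linPart α⁻¹ := by
      calc star (linPart α) = star (linPart α) * (linPart α * linPart α⁻¹) := by
            rw [linPart_mul_linPart_inv, mul_one]
        _ = linPart α⁻¹ := by rw [← mul_assoc, hstar, one_mul]
    rw [this, linPart_mul_linPart_inv]
  set N := linPart α - 1 with hN
  have hnormal : star N * N = N * star N := by
    rw [hN, star_sub, star_one, sub_mul, mul_sub, mul_sub, sub_mul, mul_sub, mul_sub, hstar, hstar']
    simp only [mul_one, one_mul]
    abel
  obtain ⟨P, q, hq0, hqm, hPle, hQle, hNP, hNQ, hcomm, u, hu1, hPu⟩ :=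
    exists_top_singular_projection N hnormal (sub_ne_zero.2 hα1)
  set m := ‖N‖ with hm
  obtain ⟨β₀, hβ₀, hβ₀n, t, ht, hβ₀t⟩ := exists_mem_almost_translation hcob hu1
    (ε := (m - q) / 8) (δ := 1 / 4) (by linarith) (by norm_num)
  have hβ₀P : 3 / 4 * t ≤ ‖P (β₀ 0)‖ := by
    have h1 : ‖P (β₀ 0) - t • u‖ ≤ 1 / 4 * t := by
      have := hPle (β₀ 0 - t • u)
      rw [map_sub, map_smul, hPu] at this
      exact this.trans hβ₀t
    have h2 := norm_sub_norm_le (t • u) (P (β₀ 0))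
    rw [norm_smul, hu1, mul_one, Real.norm_of_nonneg ht.le, norm_sub_rev] at h2
    linarith
  have hβ₀Q : ‖β₀ 0 - P (β₀ 0)‖ ≤ 1 / 4 * t := by
    have := hQle (β₀ 0 - t • u)
    rw [map_sub, map_smul, hPu, sub_sub_sub_cancel_right] at this
    exact this.trans hβ₀t
  obtain ⟨β, ⟨hβ, hβn, hβ0, hβQ⟩, hβmin⟩ := exists_min_norm_apply_zero hdisc
    (W := {φ | φ ∈ Γ ∧ ‖linPart φ - 1‖ ≤ (m - q) / 8 ∧ 0 < ‖P (φ 0)‖ ∧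
      ‖φ 0 - P (φ 0)‖ ≤ ‖P (φ 0)‖})
    ⟨β₀, hβ₀, hβ₀n, by linarith, by linarith⟩ fun φ hφ => hφ.1
  set κ := α * β * (β * α)⁻¹ with hκ
  have hκΓ : κ ∈ Γ := Γ.mul_mem (Γ.mul_mem hα hβ) (Γ.inv_mem (Γ.mul_mem hβ hα))
  have hκn : ‖linPart κ - 1‖ ≤ ‖linPart β - 1‖ := by
    refine (norm_linPart_commutator_sub_one_le α β).trans ?_
    nlinarith [norm_nonneg (linPart β - 1)]
  -- If `β` is not a translation, it competes with `α`, so minimality gives `‖α 0‖ ≤ ‖β 0‖`.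
  have hβα : ‖linPart β - 1‖ * ‖α 0‖ ≤ ‖linPart β - 1‖ * ‖β 0‖ := by
    by_cases h1 : linPart β = 1
    · simp [h1]
    · exact mul_le_mul_of_nonneg_left (hαmin β ⟨hβ, by linarith, h1⟩) (norm_nonneg _)
  set b := β 0 with hb
  set r := κ 0 - N b with hr
  have hbP : ‖b‖ ≤ 2 * ‖P b‖ := by
    have := norm_add_le (P b) (b - P b)
    rw [add_sub_cancel] at this
    linarith
  have hrb : ‖r‖ ≤ (m - q) / 4 * ‖b‖ := by
    have h1 := norm_commutator_apply_zero_sub_le α β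
    have h2 := mul_le_mul_of_nonneg_right hκn (norm_nonneg b)
    have h3 := mul_le_mul_of_nonneg_right hβn (norm_nonneg b)
    calc ‖r‖ ≤ _ := h1
      _ ≤ ‖linPart β - 1‖ * ‖b‖ + ‖linPart β - 1‖ * ‖b‖ := add_le_add h2 hβα
      _ ≤ _ := by linarith
  have hκ0 : κ 0 = N b + r := by rw [hr]; abel
  have hrP : ‖r‖ ≤ (m - q) / 2 * ‖P b‖ := by nlinarith
  have hPκ : m * ‖P b‖ - ‖r‖ ≤ ‖P (κ 0)‖ := by
    rw [hκ0, map_add, hcomm, ← hNP]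
    have h1 := norm_sub_le (N (P b) + P r) (P r)
    rw [add_sub_cancel_right] at h1
    linarith [hPle r]
  have hQκ : ‖κ 0 - P (κ 0)‖ ≤ q * ‖P b‖ + ‖r‖ := by
    have h1 : κ 0 - P (κ 0) = N (b - P b) + (r - P r) := by
      rw [map_sub N b, ← hcomm, hκ0, map_add]; abel
    rw [h1]
    refine (norm_add_le _ _).trans (add_le_add ((hNQ b).trans ?_) (hQle r))
    exact mul_le_mul_of_nonneg_left hβQ hq0
  -- The component of `κ 0` along the top space is at least `(m + q) / 2 * ‖P b‖`, the other at most
  -- that, so `κ` is admissible. Since `m ≤ 1 / 2`, its displacement is at most `5 / 8 * ‖b‖`,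
  -- contradicting the choice of `β`.
  have hκmin := hβmin κ ⟨hκΓ, hκn.trans hβn, by nlinarith, by nlinarith⟩
  have hκle : ‖κ 0‖ ≤ m * ‖b‖ + (m - q) / 4 * ‖b‖ := by
    rw [hκ0]
    exact (norm_add_le _ _).trans (add_le_add (N.le_opNorm b) hrb)
  have hbpos : 0 < ‖b‖ := hβ0.trans_le (hPle b)
  nlinarith

/-- Elements whose linear parts are within `1 / 2` differ by a translation, so distinct linear parts
are separated in a compact ball. -/
theorem finite_image_linPart [FiniteDimensional ℝ E]
    (hdisc : ∀ R : ℝ, {φ | φ ∈ Γ ∧ ‖φ 0‖ ≤ R}.Finite) {C : ℝ}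
    (hcob : ∀ x : E, ∃ φ ∈ Γ, ‖φ 0 - x‖ ≤ C) : (linPart '' (Γ : Set (E ≃ᵃⁱ[ℝ] E))).Finite := by
  refine Set.Finite.of_separated_image (f := id) (isCompact_closedBall (0 : E →L[ℝ] E) 1)
    ?_ one_half_pos ?_
  · rintro _ ⟨φ, -, rfl⟩
    simpa using norm_linPart_le φ
  · rintro _ ⟨φ, hφ, rfl⟩ _ ⟨ψ, hψ, rfl⟩ hd
    have h1 : linPart (φ * ψ⁻¹) = 1 :=
      linPart_eq_one_of_norm_sub_one_le hdisc hcob (Γ.mul_mem hφ (Γ.inv_mem hψ))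
        ((norm_linPart_mul_inv_sub_one_le φ ψ).trans (by
          rw [← dist_eq_norm]; exact hd.le))
    rw [← one_mul (linPart ψ), ← h1, ← linPart_mul, inv_mul_cancel_right]

/-- Real multiples of elements of an additive subgroup of a finite-dimensional space stay
uniformly close to the subgroup. -/
theorem AddSubgroup.exists_smul_sub_norm_le [FiniteDimensional ℝ E] (T : AddSubgroup E) :
    ∃ ν : ℝ, 0 ≤ ν ∧ ∀ x ∈ T, ∀ s : ℝ, ∃ y ∈ T, ‖s • x - y‖ ≤ ν := by
  obtain ⟨b, hbT, hspan, hli⟩ := exists_linearIndependent ℝ (T : Set E)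
  have hfin : b.Finite := hli.setFinite
  have : Fintype b := hfin.fintype
  refine ⟨∑ i : b, ‖(i : E)‖, by positivity, fun x hx s => ?_⟩
  have hmem : s • x ∈ Submodule.span ℝ (Set.range ((↑) : b → E)) := by
    rw [Subtype.range_coe, hspan]
    exact Submodule.smul_mem _ _ (Submodule.subset_span hx)
  obtain ⟨c, hc⟩ := (Submodule.mem_span_range_iff_exists_fun ℝ).1 hmem
  -- Round down the coordinates in a basis of the span consisting of elements of `T`; discreteness
  -- of `T` plays no role.
  refine ⟨∑ i : b, ⌊c i⌋ • (i : E), T.sum_mem fun i _ => T.zsmul_mem (hbT i.2) _, ?_⟩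
  rw [← hc, ← Finset.sum_sub_distrib]
  refine (norm_sum_le _ _).trans (Finset.sum_le_sum fun i _ => ?_)
  rw [← Int.cast_smul_eq_zsmul ℝ, ← sub_smul, norm_smul, Int.self_sub_floor,
    Real.norm_of_nonneg (Int.fract_nonneg _)]
  exact mul_le_of_le_one_left (norm_nonneg _) (Int.fract_lt_one _).le

/-- Orbits of subgroups of a discrete cocompact group of Euclidean isometries are quasiconvex. -/
theorem exists_orbit_zero_quasiconvex [FiniteDimensional ℝ E]
    (hdisc : ∀ R : ℝ, {φ | φ ∈ Γ ∧ ‖φ 0‖ ≤ R}.Finite) {C : ℝ}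
    (hcob : ∀ x : E, ∃ φ ∈ Γ, ‖φ 0 - x‖ ≤ C) {K : Subgroup (E ≃ᵃⁱ[ℝ] E)} (hK : K ≤ Γ) :
    ∃ ν : ℝ, 0 ≤ ν ∧ ∀ k ∈ K, ∀ s ∈ Set.Icc (0 : ℝ) 1, ∃ k' ∈ K, ‖s • k 0 - k' 0‖ ≤ ν := by
  let τ : E → E ≃ᵃⁱ[ℝ] E := AffineIsometryEquiv.constVAdd ℝ E
  let T : AddSubgroup E :=
    { carrier := {t | τ t ∈ K}
      zero_mem' := by
        have : τ 0 = 1 := by ext x; simp [τ]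
        simp [this]
      add_mem' := by
        intro a b ha hb
        have : τ (a + b) = τ a * τ b := by ext x; simp [τ, add_assoc]
        simpa [this] using K.mul_mem ha hb
      neg_mem' := by
        intro a ha
        have : τ (-a) = (τ a)⁻¹ := by
          rw [eq_inv_iff_mul_eq_one]
          ext x; simp [τ]
        simpa [this] using K.inv_mem ha }
  obtain ⟨ν, hν, hT⟩ := T.exists_smul_sub_norm_le
  -- One representative `ψ` in `K` for each of the finitely many linear parts: every `k ∈ K` is `ψ`
  -- followed by a translation belonging to `K`.
  obtain ⟨t, htK, htf, hrep⟩ := Set.Finite.exists_finite_representatives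
    ((finite_image_linPart hdisc hcob).subset (Set.image_mono hK))
  obtain ⟨R, hR, hRt⟩ := htf.exists_nonneg_upper_bound fun φ => ‖φ 0‖
  refine ⟨R + ν, by positivity, fun k hk s hs => ?_⟩
  obtain ⟨ψ, hψ, hψk⟩ := hrep k hk
  set w := k 0 - ψ 0 with hw
  have hτ : τ w = k * ψ⁻¹ := by
    rw [eq_mul_inv_iff_mul_eq]
    ext x
    change w + ψ x = k x
    rw [apply_eq_linPart_add k, apply_eq_linPart_add ψ, hψk, hw]
    abel
  have hwT : w ∈ T := by
    change τ w ∈ K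
    rw [hτ]
    exact K.mul_mem hk (K.inv_mem (htK hψ))
  obtain ⟨y, hy, hyw⟩ := hT w hwT s
  refine ⟨τ y, hy, ?_⟩
  have h0 : τ y 0 = y := by simp [τ]
  have h1 : s • k 0 - τ y 0 = s • ψ 0 + (s • w - y) := by
    rw [h0, hw, smul_sub]; abel
  rw [h1]
  refine (norm_add_le _ _).trans (add_le_add ?_ hyw)
  rw [norm_smul, Real.norm_of_nonneg hs.1]
  exact (mul_le_of_le_one_left (norm_nonneg _) hs.2).trans (hRt ψ hψ)

end Bieberbach

/-! ### Geodesic segments, properness of the space, and orbit chains. -/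

section GeometricAction

variable {X : Type*} [MetricSpace X]

theorem IsGeodesicSegment.length_eq {γ : ℝ → X} {l : ℝ} {x y : X} (h : IsGeodesicSegment γ l x y) :
    l = dist x y := by
  obtain ⟨hl, h0, h1, hd⟩ := h
  have := hd 0 ⟨le_rfl, hl⟩ l ⟨hl, le_rfl⟩
  rw [h0, h1, zero_sub, abs_neg, abs_of_nonneg hl] at this
  exact this.symm

theorem IsGeodesicSegment.dist_left {γ : ℝ → X} {l : ℝ} {x y : X} (h : IsGeodesicSegment γ l x y)
    {t : ℝ} (ht : t ∈ Set.Icc 0 l) : dist x (γ t) = t := by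
  obtain ⟨hl, h0, h1, hd⟩ := h
  have := hd 0 ⟨le_rfl, hl⟩ t ht
  rwa [h0, zero_sub, abs_neg, abs_of_nonneg ht.1] at this

theorem IsGeodesicSegment.dist_right {γ : ℝ → X} {l : ℝ} {x y : X} (h : IsGeodesicSegment γ l x y)
    {t : ℝ} (ht : t ∈ Set.Icc 0 l) : dist (γ t) y = l - t := by
  obtain ⟨hl, h0, h1, hd⟩ := h
  have := hd t ht l ⟨hl, le_rfl⟩
  rwa [h1, abs_sub_comm, abs_of_nonneg (by linarith [ht.2])] at this

theorem IsGeodesicSegment.subsegment {γ : ℝ → X} {l : ℝ} {x y : X} (h : IsGeodesicSegment γ l x y)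
    {a b : ℝ} (ha : 0 ≤ a) (hab : a ≤ b) (hb : b ≤ l) :
    IsGeodesicSegment (fun t => γ (a + t)) (b - a) (γ a) (γ b) := by
  refine ⟨by linarith, by simp, by simp, fun s hs t ht => ?_⟩
  rw [h.2.2.2 (a + s) ⟨by linarith [hs.1], by linarith [hs.2]⟩ (a + t)
    ⟨by linarith [ht.1], by linarith [ht.2]⟩]
  congr 1
  ring

theorem IsGeodesicSegment.reverse {γ : ℝ → X} {l : ℝ} {x y : X} (h : IsGeodesicSegment γ l x y) :
    IsGeodesicSegment (fun t => γ (l - t)) l y x := by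
  refine ⟨h.1, by simpa using h.2.2.1, by simpa using h.2.1, fun s hs t ht => ?_⟩
  rw [h.2.2.2 (l - s) ⟨by linarith [hs.2], by linarith [hs.1]⟩ (l - t)
    ⟨by linarith [ht.2], by linarith [ht.1]⟩, abs_sub_comm]
  congr 1
  ring

variable {G : Type*} [Group G] [MulAction G X]

theorem IsGeodesicSegment.smul [IsIsometricSMul G X] {γ : ℝ → X} {l : ℝ} {x y : X}
    (h : IsGeodesicSegment γ l x y) (g : G) :
    IsGeodesicSegment (fun t => g • γ t) l (g • x) (g • y) := by
  refine ⟨h.1, congrArg (g • ·) h.2.1, congrArg (g • ·) h.2.2.1, fun s hs t ht => ?_⟩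
  rw [dist_smul]
  exact h.2.2.2 s hs t ht

/-- A convergent sequence with its limit is compact, so it meets finitely many translates of `K`;
hence translates missing `x` cannot accumulate at `x`. A small ball at `x` is thus covered by the
finitely many translates containing `x`. -/
theorem IsGeometricAction.exists_isCompact_closedBall (hact : IsGeometricAction G X) (x : X) :
    ∃ r : ℝ, 0 < r ∧ IsCompact (Metric.closedBall x r) := by
  have := hact.isometric
  obtain ⟨K, hK, hcov⟩ := hact.cocompact
  have hpd := hact.properlyDiscontinuous
  have hgK : ∀ g : G, IsCompact ((fun y => g • y) '' K) := fun g =>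
    hK.image (isometry_smul X g).continuous
  have hx : x ∉ closure (⋃ g ∈ {g : G | x ∉ (fun y => g • y) '' K}, (fun y => g • y) '' K) := by
    intro hx
    obtain ⟨y, hy, hyx⟩ := mem_closure_iff_seq_limit.1 hx
    have hB := hpd.finite_disjoint_inter_image hK hyx.isCompact_insert_range
    have hB' := hB.subset (Set.inter_subset_left (t := {g : G | x ∉ (fun y => g • y) '' K}))
    have hcl : IsClosed (⋃ g ∈ {g : G | ((fun y => g • y) '' K ∩ insert x (Set.range y)).Nonempty} ∩
        {g : G | x ∉ (fun y => g • y) '' K}, (fun y => g • y) '' K) :=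
      hB'.isClosed_biUnion fun g _ => (hgK g).isClosed
    have hmem := hcl.mem_of_tendsto hyx (Filter.Eventually.of_forall fun n => by
      obtain ⟨g, hg, hyg⟩ := Set.mem_iUnion₂.1 (hy n)
      exact Set.mem_iUnion₂.2 ⟨g, ⟨⟨y n, hyg, Or.inr ⟨n, rfl⟩⟩, hg⟩, hyg⟩)
    obtain ⟨g, hg, hxg⟩ := Set.mem_iUnion₂.1 hmem
    exact hg.2 hxg
  obtain ⟨r, hr, hball⟩ := Metric.mem_nhds_iff.1 (isClosed_closure.isOpen_compl.mem_nhds hx)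
  refine ⟨r / 2, half_pos hr, ?_⟩
  have hfin : {g : G | x ∈ (fun y => g • y) '' K}.Finite :=
    (hpd.finite_disjoint_inter_image hK (isCompact_singleton (x := x))).subset
      fun g hg => ⟨x, hg, rfl⟩
  refine (hfin.isCompact_biUnion fun g _ => hgK g).of_isClosed_subset Metric.isClosed_closedBall ?_
  intro y hy
  obtain ⟨g, hg⟩ := Set.mem_iUnion.1 (hcov.symm ▸ Set.mem_univ y : y ∈ ⋃ g : G, (fun x => g • x) '' K)
  refine Set.mem_iUnion₂.2 ⟨g, ?_, hg⟩
  by_contra hxg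
  refine hball (Metric.closedBall_subset_ball (half_lt_self hr) hy) (subset_closure ?_)
  exact Set.mem_iUnion₂.2 ⟨g, hxg, hg⟩

theorem IsGeometricAction.exists_uniform_isCompact_closedBall (hact : IsGeometricAction G X) :
    ∃ r : ℝ, 0 < r ∧ ∀ x : X, IsCompact (Metric.closedBall x r) := by
  have := hact.isometric
  obtain ⟨K, hK, hcov⟩ := hact.cocompact
  choose r hr hc using hact.exists_isCompact_closedBall
  obtain ⟨δ, hδ, hsub⟩ := lebesgue_number_lemma_of_metric (c := fun x => Metric.ball x (r x)) hK
    (fun _ => Metric.isOpen_ball) (fun x _ => Set.mem_iUnion.2 ⟨x, Metric.mem_ball_self (hr x)⟩)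
  refine ⟨δ / 2, half_pos hδ, fun y => ?_⟩
  obtain ⟨g, x, hx, rfl⟩ :=
    Set.mem_iUnion.1 (hcov.symm ▸ Set.mem_univ y : y ∈ ⋃ g : G, (fun x => g • x) '' K)
  obtain ⟨i, hi⟩ := hsub x hx
  have h1 : IsCompact (Metric.closedBall x (δ / 2)) :=
    (hc i).of_isClosed_subset Metric.isClosed_closedBall
      ((Metric.closedBall_subset_ball (half_lt_self hδ)).trans
        (hi.trans Metric.ball_subset_closedBall))
  have h2 := h1.image (isometry_smul X g).continuous
  have h3 := (IsometryEquiv.constSMul (X := X) g).image_closedBall x (δ / 2)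
  rw [IsometryEquiv.constSMul_apply] at h3
  rw [← h3]
  exact h2

/-- Hopf–Rinow with a uniform radius `r`: cover a compact ball by finitely many balls of radius `r /
2`. Following geodesics, the concentric ball that is larger by `r / 2` is covered by the compact
balls of radius `r`. -/
theorem IsGeometricAction.properSpace (hact : IsGeometricAction G X)
    (hgeo : ∀ x y : X, ∃ (γ : ℝ → X) (l : ℝ), IsGeodesicSegment γ l x y) : ProperSpace X := by
  obtain ⟨r, hr, hc⟩ := hact.exists_uniform_isCompact_closedBall
  have key : ∀ (x : X) (n : ℕ), IsCompact (Metric.closedBall x (n * (r / 2))) := by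
    intro x n
    induction n with
    | zero => simp
    | succ n ih =>
      obtain ⟨t, -, htf, hcov⟩ := ih.finite_cover_balls (half_pos hr)
      refine (htf.isCompact_biUnion fun c _ => hc c).of_isClosed_subset
        Metric.isClosed_closedBall fun y hy => ?_
      rw [Metric.mem_closedBall', Nat.cast_succ, add_mul, one_mul] at hy
      obtain ⟨γ, l, hγ⟩ := hgeo x y
      have hl := hγ.length_eq
      have hmem : min l (n * (r / 2)) ∈ Set.Icc 0 l := ⟨le_min hγ.1 (by positivity), min_le_left _ _⟩
      have h1 := hγ.dist_left hmem
      have h2 := hγ.dist_right hmem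
      have h3 : γ (min l (n * (r / 2))) ∈ Metric.closedBall x (n * (r / 2)) := by
        rw [Metric.mem_closedBall', h1]
        exact min_le_right _ _
      obtain ⟨c, hct, hcz⟩ := Set.mem_iUnion₂.1 (hcov h3)
      refine Set.mem_iUnion₂.2 ⟨c, hct, ?_⟩
      rw [Metric.mem_closedBall]
      rw [Metric.mem_ball] at hcz
      have h4 := dist_triangle_left y c (γ (min l (n * (r / 2))))
      have h5 : l - min l (n * (r / 2)) ≤ r / 2 := by
        rcases min_cases l (n * (r / 2)) with h | h <;> linarith
      linarith
  refine ⟨fun x R => ?_⟩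
  obtain ⟨n, hn⟩ := exists_nat_ge (R / (r / 2))
  rw [div_le_iff₀ (half_pos hr)] at hn
  exact (key x n).of_isClosed_subset Metric.isClosed_closedBall (Metric.closedBall_subset_closedBall hn)

theorem IsGeometricAction.finite_dist_smul_le [ProperSpace X] (hact : IsGeometricAction G X) (x : X)
    (R : ℝ) : {g : G | dist x (g • x) ≤ R}.Finite := by
  refine (hact.properlyDiscontinuous.finite_disjoint_inter_image (isCompact_singleton (x := x))
    (isCompact_closedBall x R)).subset fun g hg => ⟨g • x, ⟨x, rfl, rfl⟩, ?_⟩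
  rw [Metric.mem_closedBall']
  exact hg

theorem IsGeometricAction.exists_dist_smul_le (hact : IsGeometricAction G X) (x : X) :
    ∃ C : ℝ, 0 ≤ C ∧ ∀ y : X, ∃ g : G, dist y (g • x) ≤ C := by
  have := hact.isometric
  obtain ⟨K, hK, hcov⟩ := hact.cocompact
  obtain ⟨C, hC⟩ := hK.isBounded.subset_closedBall x
  refine ⟨max C 0, le_max_right _ _, fun y => ?_⟩
  obtain ⟨g, z, hz, rfl⟩ :=
    Set.mem_iUnion.1 (hcov.symm ▸ Set.mem_univ y : y ∈ ⋃ g : G, (fun x => g • x) '' K)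
  refine ⟨g, ?_⟩
  simp only [dist_smul]
  exact (Metric.mem_closedBall.1 (hC hz)).trans (le_max_left _ _)

/-- An orbit that is coarsely dense along a geodesic from `x` to `g • x` contains a chain of
uniformly short steps from `x` to `g • x`. -/
theorem IsGeodesicSegment.exists_orbit_chain {γ : ℝ → X} {l : ℝ} {x : X} {g : G}
    (hγ : IsGeodesicSegment γ l x (g • x)) {ν : ℝ} (hν : 0 ≤ ν)
    (hnear : ∀ t ∈ Set.Icc 0 l, ∃ h : G, dist (γ t) (h • x) ≤ ν) :
    ∃ (n : ℕ) (p : ℕ → G), (n : ℝ) ≤ l + 2 ∧ p 0 = 1 ∧ p n = g ∧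
      ∀ i < n, dist (p i • x) (p (i + 1) • x) ≤ 2 * ν + 1 := by
  have hl := hγ.1
  -- The extra `1` keeps `n` positive when `l = 0`; the subdivision has mesh at most `1`.
  set n := ⌈l⌉₊ + 1 with hn
  have hn0 : (0 : ℝ) < n := by positivity
  have hnl : l ≤ n := (Nat.le_ceil l).trans (by rw [hn]; push_cast; linarith)
  have hmem : ∀ i ≤ n, (i : ℝ) * (l / n) ∈ Set.Icc 0 l := fun i hi => by
    refine ⟨by positivity, ?_⟩
    rw [mul_div_assoc', div_le_iff₀ hn0, mul_comm]
    gcongr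
  have hex : ∀ i : ℕ, ∃ h : G, (i ≤ n → dist (γ (i * (l / n))) (h • x) ≤ ν) ∧ (i = 0 → h = 1) ∧
      (i = n → h = g) := by
    intro i
    by_cases h0 : i = 0
    · refine ⟨1, fun _ => ?_, fun _ => rfl, fun h => by omega⟩
      rw [h0, Nat.cast_zero, zero_mul, hγ.2.1, one_smul, dist_self]
      exact hν
    by_cases h1 : i = n
    · refine ⟨g, fun _ => ?_, fun h => absurd h h0, fun _ => rfl⟩
      rw [h1, mul_div_cancel₀ _ hn0.ne', hγ.2.2.1, dist_self]
      exact hν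
    by_cases h2 : i ≤ n
    · obtain ⟨h, hh⟩ := hnear _ (hmem i h2)
      exact ⟨h, fun _ => hh, fun h => absurd h h0, fun h => absurd h h1⟩
    · exact ⟨1, fun h => absurd h h2, fun _ => rfl, fun h => absurd h h1⟩
  choose p hp hp0 hpn using hex
  refine ⟨n, p, ?_, hp0 0 rfl, hpn n rfl, fun i hi => ?_⟩
  · rw [hn]
    push_cast
    linarith [Nat.ceil_lt_add_one hl]
  · have h1 := hp i hi.le
    have h2 := hp (i + 1) hi
    have h3 := hγ.2.2.2 _ (hmem i hi.le) _ (hmem (i + 1) hi)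
    have h4 : (i : ℝ) * (l / n) - (i + 1 : ℕ) * (l / n) = -(l / n) := by push_cast; ring
    rw [h4, abs_neg, abs_of_nonneg (by positivity)] at h3
    have h5 : l / n ≤ 1 := (div_le_one hn0).2 hnl
    have h6 := dist_triangle4 (p i • x) (γ (i * (l / n)))
      (γ ((i + 1 : ℕ) * (l / n))) (p (i + 1) • x)
    rw [dist_comm (p i • x) (γ _)] at h6
    linarith

end GeometricAction

/-! ### Word metrics and the Milnor–Švarc argument. -/

section WordLength

variable {G : Type*} [Group G] {S : Set G}

theorem wordLength_prod_le (l : List G) (hl : ∀ x ∈ l, x ∈ S ∨ x⁻¹ ∈ S) :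
    wordLength S l.prod ≤ l.length :=
  Nat.sInf_le ⟨l, rfl, hl, rfl⟩

theorem IsFiniteGeneratingSet.exists_word (hS : IsFiniteGeneratingSet S) (g : G) :
    ∃ l : List G, l.length = wordLength S g ∧ (∀ x ∈ l, x ∈ S ∨ x⁻¹ ∈ S) ∧ l.prod = g := by
  have hg : g ∈ Subgroup.closure S := hS.2 ▸ Subgroup.mem_top g
  rw [← Subgroup.mem_toSubmonoid, Subgroup.closure_toSubmonoid] at hg
  obtain ⟨l, hl, hlg⟩ := Submonoid.exists_list_of_mem_closure hg
  exact Nat.sInf_mem (s := {n : ℕ | ∃ l : List G, l.length = n ∧ (∀ x ∈ l, x ∈ S ∨ x⁻¹ ∈ S) ∧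
    l.prod = g}) ⟨_, l, rfl, hl, hlg⟩

theorem wordLength_one : wordLength S (1 : G) = 0 :=
  Nat.le_zero.1 (wordLength_prod_le (S := S) [] (by simp))

theorem IsFiniteGeneratingSet.wordLength_mul_le (hS : IsFiniteGeneratingSet S) (g h : G) :
    wordLength S (g * h) ≤ wordLength S g + wordLength S h := by
  obtain ⟨l, hl, hlS, rfl⟩ := hS.exists_word g
  obtain ⟨l', hl', hlS', rfl⟩ := hS.exists_word h
  rw [← hl, ← hl', ← List.prod_append, ← List.length_append]
  refine wordLength_prod_le _ fun x hx => ?_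
  rcases List.mem_append.1 hx with h | h
  · exact hlS x h
  · exact hlS' x h

/-- A geodesic word of `g`, as the sequence of its prefixes. -/
theorem IsFiniteGeneratingSet.exists_geodesic_word (hS : IsFiniteGeneratingSet S) (g : G) :
    ∃ p : ℕ → G, p 0 = 1 ∧ p (wordLength S g) = g ∧
      ∀ i j, i ≤ j → j ≤ wordLength S g → wordLength S ((p i)⁻¹ * p j) = j - i := by
  obtain ⟨l, hl, hlS, hlg⟩ := hS.exists_word g
  refine ⟨fun i => (l.take i).prod, by simp, by simp [← hl, hlg], fun i j hij hj => ?_⟩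
  have hsub : ((l.take i).prod)⁻¹ * (l.take j).prod = ((l.take j).drop i).prod := by
    rw [inv_mul_eq_iff_eq_mul, ← List.prod_take_mul_prod_drop (l.take j) i, List.take_take,
      min_eq_left hij]
  have hi : wordLength S (l.take i).prod ≤ i :=
    (wordLength_prod_le _ fun x hx => hlS x (List.mem_of_mem_take hx)).trans (by simp)
  have hd : wordLength S (l.drop j).prod ≤ wordLength S g - j :=
    (wordLength_prod_le _ fun x hx => hlS x (List.mem_of_mem_drop hx)).trans (by simp [hl])
  have hm : wordLength S (((l.take i).prod)⁻¹ * (l.take j).prod) ≤ j - i := by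
    rw [hsub]
    refine (wordLength_prod_le _ fun x hx =>
      hlS x (List.mem_of_mem_take (List.mem_of_mem_drop hx))).trans ?_
    simp only [List.length_drop, List.length_take]
    omega
  have h1 := hS.wordLength_mul_le (l.take i).prod (((l.take i).prod)⁻¹ * (l.take j).prod)
  rw [mul_inv_cancel_left] at h1
  have h2 := hS.wordLength_mul_le (l.take j).prod (l.drop j).prod
  rw [List.prod_take_mul_prod_drop, hlg] at h2
  change wordLength S (((l.take i).prod)⁻¹ * (l.take j).prod) = j - i
  omega

variable {X : Type*} [MetricSpace X] [MulAction G X] [IsIsometricSMul G X]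

theorem IsFiniteGeneratingSet.exists_dist_smul_le_mul_wordLength (hS : IsFiniteGeneratingSet S)
    (x : X) : ∃ M : ℝ, 0 ≤ M ∧ ∀ g : G, dist x (g • x) ≤ M * wordLength S g := by
  obtain ⟨M, hM, hMS⟩ := hS.1.exists_nonneg_upper_bound fun s => dist x (s • x)
  refine ⟨M, hM, fun g => ?_⟩
  obtain ⟨l, hl, hlS, rfl⟩ := hS.exists_word g
  rw [← hl]
  clear hl
  induction l with
  | nil => simp
  | cons s l ih =>
    have h1 := ih fun y hy => hlS y (List.mem_cons_of_mem _ hy)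
    have h2 : dist x (s • x) ≤ M := by
      rcases hlS s List.mem_cons_self with h | h
      · exact hMS s h
      · have := hMS _ h
        rwa [← dist_smul s, smul_inv_smul, dist_comm] at this
    rw [List.prod_cons, List.length_cons, mul_smul]
    have h3 := dist_triangle x (s • x) (s • l.prod • x)
    rw [dist_smul] at h3
    push_cast
    linarith

theorem closure_dist_smul_le_eq_top {x : X} {ν : ℝ} (hν : 0 ≤ ν)
    (hq : ∀ g : G, ∃ (γ : ℝ → X) (l : ℝ), IsGeodesicSegment γ l x (g • x) ∧
      ∀ t ∈ Set.Icc 0 l, ∃ h : G, dist (γ t) (h • x) ≤ ν) :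
    Subgroup.closure {g : G | dist x (g • x) ≤ 2 * ν + 1} = ⊤ := by
  refine (Subgroup.eq_top_iff' _).2 fun g => ?_
  obtain ⟨γ, l, hγ, hnear⟩ := hq g
  obtain ⟨n, p, -, hp0, hpn, hstep⟩ := hγ.exists_orbit_chain hν hnear
  have key : ∀ i ≤ n, p i ∈ Subgroup.closure {g : G | dist x (g • x) ≤ 2 * ν + 1} := by
    intro i
    induction i with
    | zero => exact fun _ => hp0 ▸ Subgroup.one_mem _
    | succ i ih =>
      intro hi
      rw [← mul_inv_cancel_left (p i) (p (i + 1))]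
      refine Subgroup.mul_mem _ (ih (by omega)) (Subgroup.subset_closure ?_)
      rw [Set.mem_ofPred_eq, ← dist_smul (p i), ← mul_smul, mul_inv_cancel_left]
      exact hstep i hi
  exact hpn ▸ key n le_rfl

/-- Each step of an orbit chain is one of finitely many group elements. The hypothesis asks only for
geodesics near the orbit, so it covers both the cobounded action of `G` and a quasiconvex orbit of
`H`. -/
theorem IsFiniteGeneratingSet.exists_wordLength_le_mul_dist (hS : IsFiniteGeneratingSet S) {x : X}
    (hfin : ∀ R : ℝ, {g : G | dist x (g • x) ≤ R}.Finite) {ν : ℝ} (hν : 0 ≤ ν)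
    (hq : ∀ g : G, ∃ (γ : ℝ → X) (l : ℝ), IsGeodesicSegment γ l x (g • x) ∧
      ∀ t ∈ Set.Icc 0 l, ∃ h : G, dist (γ t) (h • x) ≤ ν) :
    ∃ C : ℝ, 0 ≤ C ∧ ∀ g : G, (wordLength S g : ℝ) ≤ C * (dist x (g • x) + 2) := by
  obtain ⟨C, hC, hCU⟩ := (hfin (2 * ν + 1)).exists_nonneg_upper_bound fun g => (wordLength S g : ℝ)
  refine ⟨C, hC, fun g => ?_⟩
  obtain ⟨γ, l, hγ, hnear⟩ := hq g
  obtain ⟨n, p, hnl, hp0, hpn, hstep⟩ := hγ.exists_orbit_chain hν hnear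
  have key : ∀ i ≤ n, (wordLength S (p i) : ℝ) ≤ C * i := by
    intro i
    induction i with
    | zero => simp [hp0, wordLength_one]
    | succ i ih =>
      intro hi
      have h1 := hS.wordLength_mul_le (p i) ((p i)⁻¹ * p (i + 1))
      rw [mul_inv_cancel_left] at h1
      have h2 : (wordLength S ((p i)⁻¹ * p (i + 1)) : ℝ) ≤ C := by
        refine hCU _ ?_
        rw [Set.mem_ofPred_eq, ← dist_smul (p i), ← mul_smul, mul_inv_cancel_left]
        exact hstep i hi
      have h3 := ih (by omega)
      have h4 : (wordLength S (p (i + 1)) : ℝ) ≤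
          wordLength S (p i) + wordLength S ((p i)⁻¹ * p (i + 1)) := by exact_mod_cast h1
      push_cast
      linarith
  rw [← hγ.length_eq]
  have := key n le_rfl
  rw [hpn] at this
  exact this.trans (mul_le_mul_of_nonneg_left hnl hC)

end WordLength

/-! ### Comparison triangles and convexity of the CAT(0) metric. -/

section ComparisonTriangle

theorem EuclideanSpace.exists_triangle {a b c : ℝ} (ha : 0 ≤ a) (hb : 0 ≤ b) (hc : 0 ≤ c)
    (hab : c ≤ a + b) (hac : b ≤ a + c) (hbc : a ≤ b + c) :
    ∃ p q r : EuclideanSpace ℝ (Fin 2), dist p q = a ∧ dist p r = b ∧ dist q r = c := by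
  rcases ha.eq_or_lt with rfl | ha'
  · have hbc' : b = c := by linarith
    refine ⟨!₂[0, 0], !₂[0, 0], !₂[b, 0], ?_, ?_, ?_⟩ <;>
      simp [EuclideanSpace.dist_eq, Fin.sum_univ_two, Real.sqrt_sq, Real.dist_eq, ← hbc', hb]
  -- The third vertex comes from the law of cosines; its height is real by Heron's factorization.
  · set u := (a ^ 2 + b ^ 2 - c ^ 2) / (2 * a) with hu
    have hua : 2 * a * u = a ^ 2 + b ^ 2 - c ^ 2 := by rw [hu]; field_simp
    have hv : 0 ≤ b ^ 2 - u ^ 2 := by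
      have h1 : 0 ≤ (2 * a) ^ 2 * (b ^ 2 - u ^ 2) := by
        have h2 : (2 * a) ^ 2 * (b ^ 2 - u ^ 2) =
            ((a + b + c) * (a + b - c)) * ((a + c - b) * (b + c - a)) := by
          have : (2 * a) ^ 2 * (b ^ 2 - u ^ 2) = (2 * a * b) ^ 2 - (2 * a * u) ^ 2 := by ring
          rw [this, hua]
          ring
        rw [h2]
        have h3 : 0 ≤ a + b - c := by linarith
        have h4 : 0 ≤ a + c - b := by linarith
        have h5 : 0 ≤ b + c - a := by linarith
        positivity
      exact nonneg_of_mul_nonneg_right h1 (by positivity)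
    have hsq := Real.sq_sqrt hv
    refine ⟨!₂[0, 0], !₂[a, 0], !₂[u, √(b ^ 2 - u ^ 2)], ?_, ?_, ?_⟩
    · simp [EuclideanSpace.dist_eq, Fin.sum_univ_two, Real.sqrt_sq, Real.dist_eq, ha]
    · simp [EuclideanSpace.dist_eq, Fin.sum_univ_two, Real.dist_eq, hsq, Real.sqrt_sq hb]
    · rw [EuclideanSpace.dist_eq, Fin.sum_univ_two, ← Real.sqrt_sq hc]
      congr 1
      simp only [Real.dist_eq, sq_abs]
      simp
      nlinarith

variable {X : Type*} [MetricSpace X]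

theorem IsCATZero.dist_le_of_common_start (hcat : IsCATZero X) {γ γ' : ℝ → X} {l l' : ℝ}
    {p q r : X} (hγ : IsGeodesicSegment γ l p q) (hγ' : IsGeodesicSegment γ' l' p r) {τ : ℝ}
    (hτ : τ ∈ Set.Icc (0 : ℝ) 1) : dist (γ (τ * l)) (γ' (τ * l')) ≤ dist q r := by
  have hl := hγ.length_eq
  have hl' := hγ'.length_eq
  obtain ⟨p₀, q₀, r₀, hpq, hpr, hqr⟩ := EuclideanSpace.exists_triangle (a := dist p q)
    (b := dist p r) (c := dist q r) dist_nonneg dist_nonneg dist_nonneg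
    (dist_triangle_left _ _ _) (dist_triangle _ _ _) (dist_triangle_right _ _ _)
  have hmem : τ * l ∈ Set.Icc 0 l :=
    ⟨mul_nonneg hτ.1 hγ.1, mul_le_of_le_one_left hγ.1 hτ.2⟩
  have hmem' : τ * l' ∈ Set.Icc 0 l' :=
    ⟨mul_nonneg hτ.1 hγ'.1, mul_le_of_le_one_left hγ'.1 hτ.2⟩
  have h := hcat.2 p q r γ γ' l l' hγ hγ' p₀ q₀ r₀ hpq hpr hqr _ hmem _ hmem'
    (AffineMap.lineMap p₀ q₀ τ) (by rw [segment_eq_image_lineMap]; exact ⟨τ, hτ, rfl⟩)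
    (AffineMap.lineMap p₀ r₀ τ) (by rw [segment_eq_image_lineMap]; exact ⟨τ, hτ, rfl⟩)
    (by rw [dist_left_lineMap, hγ.dist_left hmem, hpq, ← hl, Real.norm_of_nonneg hτ.1])
    (by rw [dist_left_lineMap, hγ'.dist_left hmem', hpr, ← hl', Real.norm_of_nonneg hτ.1])
  refine h.trans ?_
  have h1 : dist (AffineMap.lineMap p₀ q₀ τ) (AffineMap.lineMap p₀ r₀ τ) = τ * dist q₀ r₀ := by
    rw [dist_eq_norm, dist_eq_norm, AffineMap.lineMap_apply_module, AffineMap.lineMap_apply_module,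
      add_sub_add_left_eq_sub, ← smul_sub, norm_smul, Real.norm_of_nonneg hτ.1]
  rw [h1, hqr]
  exact mul_le_of_le_one_left dist_nonneg hτ.2

/-- A diagonal cuts the quadrilateral into two triangles, each handled by the common-endpoint case.
-/
theorem IsCATZero.dist_le_dist_add_dist (hcat : IsCATZero X) {γ γ' : ℝ → X} {l l' : ℝ}
    {x y x' y' : X} (hγ : IsGeodesicSegment γ l x y) (hγ' : IsGeodesicSegment γ' l' x' y') {τ : ℝ}
    (hτ : τ ∈ Set.Icc (0 : ℝ) 1) :
    dist (γ (τ * l)) (γ' (τ * l')) ≤ dist x x' + dist y y' := by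
  obtain ⟨γ'', l'', hγ''⟩ := hcat.1 x y'
  have h1 := hcat.dist_le_of_common_start hγ hγ'' hτ
  have h2 := hcat.dist_le_of_common_start hγ''.reverse hγ'.reverse (τ := 1 - τ)
    ⟨by linarith [hτ.2], by linarith [hτ.1]⟩
  have e : ∀ m : ℝ, m - (1 - τ) * m = τ * m := fun m => by ring
  simp only [e] at h2
  linarith [dist_triangle (γ (τ * l)) (γ'' (τ * l'')) (γ' (τ * l'))]

end ComparisonTriangle

/-! ### Local finiteness of the family of flats. -/

theorem IsFlat.exists_dist_eq {X : Type*} [MetricSpace X] {F : Set X} (hF : IsFlat F) {x : X}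
    (hx : x ∈ F) {D : ℝ} (hD : 0 ≤ D) : ∃ y ∈ F, dist x y = D := by
  obtain ⟨k, f, hk, hf, rfl⟩ := hF
  obtain ⟨w, rfl⟩ := hx
  have : Nonempty (Fin k) := ⟨⟨0, by omega⟩⟩
  obtain ⟨e, he⟩ := exists_norm_eq (EuclideanSpace ℝ (Fin k)) hD
  exact ⟨f (w + e), ⟨_, rfl⟩, by rw [hf.dist_eq, dist_self_add_right, he]⟩

/-- Mark each flat by a point `u` near `x` and a point `v` farther than `ψ 1` from `u`. If the marks
of two flats are within `1`, their `1`-neighbourhoods share a set of diameter above `ψ 1`, so the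
flats coincide; the marks lie in a compact set. -/
theorem finite_flats_near {X : Type*} [MetricSpace X] [ProperSpace X] {𝓕 : Set (Set X)}
    (hflat : ∀ F ∈ 𝓕, IsFlat F) {ψ : ℝ → ℝ}
    (hψ : ∀ F₁ ∈ 𝓕, ∀ F₂ ∈ 𝓕, F₁ ≠ F₂ → ∀ k : ℝ, 0 ≤ k →
      ∀ x ∈ Metric.cthickening k F₁ ∩ Metric.cthickening k F₂,
      ∀ y ∈ Metric.cthickening k F₁ ∩ Metric.cthickening k F₂, dist x y ≤ ψ k) (x : X) (M : ℝ) :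
    {F | F ∈ 𝓕 ∧ ∃ y ∈ F, dist y x ≤ M}.Finite := by
  have hex : ∀ F : Set X, ∃ u v : X, F ∈ 𝓕 ∧ (∃ y ∈ F, dist y x ≤ M) →
      u ∈ F ∧ v ∈ F ∧ dist u x ≤ M ∧ dist u v = max (ψ 1) 0 + 1 := by
    intro F
    by_cases h : F ∈ 𝓕 ∧ ∃ y ∈ F, dist y x ≤ M
    · obtain ⟨hF, u, hu, hux⟩ := h
      obtain ⟨v, hv, huv⟩ := (hflat F hF).exists_dist_eq hu (D := max (ψ 1) 0 + 1) (by positivity)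
      exact ⟨u, v, fun _ => ⟨hu, hv, hux, huv⟩⟩
    · exact ⟨x, x, fun h' => absurd h' h⟩
  choose u v huv using hex
  refine Set.Finite.of_separated_image (f := fun F => (u F, v F))
    ((isCompact_closedBall x M).prod (isCompact_closedBall x (M + (max (ψ 1) 0 + 1)))) ?_
    zero_lt_one ?_
  · intro F hF
    obtain ⟨-, -, h1, h2⟩ := huv F hF
    refine ⟨h1, ?_⟩
    rw [Metric.mem_closedBall]
    have := dist_triangle_left (v F) x (u F)
    linarith
  · intro F hF F' hF' hd
    by_contra hne
    obtain ⟨hu, hv, -, h2⟩ := huv F hF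
    obtain ⟨hu', hv', -, -⟩ := huv F' hF'
    rw [Prod.dist_eq, max_lt_iff] at hd
    have := hψ F hF.1 F' hF'.1 hne 1 zero_le_one (u F)
      ⟨Metric.self_subset_cthickening F hu, Metric.mem_cthickening_of_dist_le _ _ _ _ hu' hd.1.le⟩ (v F)
      ⟨Metric.self_subset_cthickening F hv, Metric.mem_cthickening_of_dist_le _ _ _ _ hv' hd.2.le⟩
    rw [h2] at this
    linarith [le_max_left (ψ 1) 0]

/-! ### Stabilizers of flats and geodesics inside flats. -/

section FlatStabilizer

open scoped Pointwise

variable {G X : Type*} [Group G] [MetricSpace X] [MulAction G X]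

/-- Pigeonhole: the flats `h⁻¹ • F` come near `x`, so they are finitely many, and `h⁻¹ • F = g⁻¹ •
F` makes `h * g⁻¹` stabilize `F`. -/
theorem exists_mem_stabilizer_dist_le [IsIsometricSMul G X] {𝓕 : Set (Set X)}
    (hinv : ∀ g : G, ∀ F ∈ 𝓕, g • F ∈ 𝓕) {x : X} {M : ℝ}
    (hfin : {F | F ∈ 𝓕 ∧ ∃ y ∈ F, dist y x ≤ M}.Finite) (H : Subgroup G) {F : Set X} (hF : F ∈ 𝓕) :
    ∃ R : ℝ, 0 ≤ R ∧ ∀ h ∈ H, (∃ y ∈ F, dist y (h • x) ≤ M) →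
      ∃ k ∈ H, k • F = F ∧ dist (h • x) (k • x) ≤ R := by
  obtain ⟨t, hts, htf, hrep⟩ := Set.Finite.exists_finite_representatives
    (s := {h : G | h ∈ H ∧ ∃ y ∈ F, dist y (h • x) ≤ M}) (g := fun h => h⁻¹ • F) (hfin.subset (by
      rintro _ ⟨h, ⟨-, y, hy, hyx⟩, rfl⟩
      refine ⟨hinv _ _ hF, h⁻¹ • y, Set.smul_mem_smul_set hy, ?_⟩
      rwa [← dist_smul h, smul_inv_smul]))
  obtain ⟨R, hR, hRt⟩ := htf.exists_nonneg_upper_bound fun h => dist (h • x) x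
  refine ⟨R, hR, fun h hh hy => ?_⟩
  obtain ⟨g, hg, hgh⟩ := hrep h ⟨hh, hy⟩
  refine ⟨h * g⁻¹, H.mul_mem hh (H.inv_mem (hts hg).1), ?_, ?_⟩
  · change g⁻¹ • F = h⁻¹ • F at hgh
    rw [mul_smul, hgh, smul_inv_smul]
  · rw [mul_smul, dist_smul, ← dist_smul g, smul_inv_smul]
    exact hRt g hg

variable {E : Type*} [NormedAddCommGroup E] [InnerProductSpace ℝ E]

/-- The group of isometries of `E` induced, through `f : E → X`, by elements of `H`. -/
def inducedIsometries (f : E → X) (H : Subgroup G) : Subgroup (E ≃ᵃⁱ[ℝ] E) where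
  carrier := {φ | ∃ h ∈ H, ∀ x, f (φ x) = h • f x}
  one_mem' := ⟨1, H.one_mem, by simp⟩
  mul_mem' := by
    rintro φ ψ ⟨g, hg, hφ⟩ ⟨h, hh, hψ⟩
    exact ⟨g * h, H.mul_mem hg hh, fun x => by
      rw [AffineIsometryEquiv.coe_mul, Function.comp_apply, hφ, hψ, mul_smul]⟩
  inv_mem' := by
    rintro φ ⟨g, hg, hφ⟩
    refine ⟨g⁻¹, H.inv_mem hg, fun x => ?_⟩
    rw [eq_inv_smul_iff, ← hφ, AffineIsometryEquiv.coe_inv, AffineIsometryEquiv.apply_symm_apply]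

omit [MetricSpace X] in
theorem inducedIsometries_mono (f : E → X) {H K : Subgroup G} (h : H ≤ K) :
    inducedIsometries f H ≤ inducedIsometries f K := by
  rintro φ ⟨g, hg, hφ⟩
  exact ⟨g, h hg, hφ⟩

variable [IsIsometricSMul G X]

theorem exists_induced_isometry {f : E → X} (hf : Isometry f) {k : G}
    (hk : k • Set.range f = Set.range f) : ∃ φ : E ≃ᵃⁱ[ℝ] E, ∀ x, f (φ x) = k • f x := by
  have h1 : ∀ x, ∃ y, f y = k • f x := fun x =>
    hk.subset (Set.smul_mem_smul_set (Set.mem_range_self x))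
  choose φ hφ using h1
  have hiso : Isometry φ := Isometry.of_dist_eq fun x y => by
    rw [← hf.dist_eq, hφ, hφ, dist_smul, hf.dist_eq]
  have hsurj : Function.Surjective φ := fun y => by
    obtain ⟨_, ⟨x, rfl⟩, hx⟩ := hk.symm.subset (Set.mem_range_self y)
    exact ⟨x, hf.injective ((hφ x).trans hx)⟩
  refine ⟨(IsometryEquiv.mk (Equiv.ofBijective φ ⟨hiso.injective, hsurj⟩)
    hiso).toRealAffineIsometryEquiv, fun x => ?_⟩
  rw [IsometryEquiv.coeFn_toRealAffineIsometryEquiv]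
  exact hφ x

omit [IsIsometricSMul G X] in
theorem finite_inducedIsometries {f : E → X} (hf : Isometry f)
    (hfin : ∀ (x : X) (R : ℝ), {g : G | dist x (g • x) ≤ R}.Finite) (H : Subgroup G) (R : ℝ) :
    {φ | φ ∈ inducedIsometries f H ∧ ‖φ 0‖ ≤ R}.Finite := by
  have hex : ∀ φ : E ≃ᵃⁱ[ℝ] E, ∃ g : G, φ ∈ inducedIsometries f H → ∀ x, f (φ x) = g • f x := by
    intro φ
    by_cases h : φ ∈ inducedIsometries f H
    · obtain ⟨g, -, hg⟩ := h
      exact ⟨g, fun _ => hg⟩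
    · exact ⟨1, fun h' => absurd h' h⟩
  choose g hg using hex
  refine Set.Finite.of_finite_image (f := g) ((hfin (f 0) R).subset ?_) ?_
  · rintro _ ⟨φ, ⟨hφ, hR⟩, rfl⟩
    rw [Set.mem_ofPred_eq, ← hg φ hφ, hf.dist_eq, dist_zero_left]
    exact hR
  · rintro φ ⟨hφ, -⟩ ψ ⟨hψ, -⟩ h
    ext x
    exact hf.injective (by rw [hg φ hφ, hg ψ hψ, h])

theorem isGeodesicSegment_lineMap {f : E → X} (hf : Isometry f) (p q : E) :
    IsGeodesicSegment (fun t => f (AffineMap.lineMap p q (t / dist p q))) (dist p q) (f p) (f q) := by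
  rcases eq_or_ne p q with rfl | hne
  · refine ⟨dist_nonneg, by simp, by simp, fun s hs t ht => ?_⟩
    rw [dist_self] at hs ht
    rw [le_antisymm hs.2 hs.1, le_antisymm ht.2 ht.1]
    simp
  · have hd : 0 < dist p q := dist_pos.2 hne
    refine ⟨hd.le, by simp, by simp [hd.ne'], fun s _ t _ => ?_⟩
    rw [hf.dist_eq, dist_lineMap_lineMap, Real.dist_eq, ← sub_div, abs_div, abs_of_pos hd,
      div_mul_cancel₀ _ hd.ne']

/-- Geodesics in a flat whose endpoints are close to the orbit of a subgroup `H` stay close to this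
orbit: the bound is uniform for a fixed flat and a fixed endpoint. -/
theorem exists_geodesic_near_orbit_of_mem_flat (hact : IsGeometricAction G X)
    [ProperSpace X] {𝓕 : Set (Set X)} (hflat : ∀ F ∈ 𝓕, IsFlat F)
    (hinv : ∀ g : G, ∀ F ∈ 𝓕, g • F ∈ 𝓕) {x : X}
    (hfin : ∀ M : ℝ, {F | F ∈ 𝓕 ∧ ∃ y ∈ F, dist y x ≤ M}.Finite) (H : Subgroup G) (M : ℝ)
    {F : Set X} (hF : F ∈ 𝓕) :
    ∃ R : ℝ, ∀ h ∈ H, ∀ P ∈ F, ∀ Q ∈ F, dist P x ≤ M → dist Q (h • x) ≤ M →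
      ∃ (γ : ℝ → X) (l : ℝ), IsGeodesicSegment γ l P Q ∧
        ∀ t ∈ Set.Icc 0 l, ∃ h' ∈ H, dist (γ t) (h' • x) ≤ R := by
  obtain ⟨k, f, -, hf, hrange⟩ := hflat F hF
  have hdisc := finite_inducedIsometries hf hact.finite_dist_smul_le (⊤ : Subgroup G)
  obtain ⟨C, -, hC⟩ := hact.exists_dist_smul_le x
  obtain ⟨R₀, -, hR₀⟩ := exists_mem_stabilizer_dist_le hinv (hfin C) ⊤ hF
  -- The full stabilizer of `F` acts coboundedly on it: a point of `F` is near some `g • x`, hence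
  -- near `k • x` with `k` stabilizing `F`.
  have hcob : ∀ y, ∃ φ ∈ inducedIsometries f (⊤ : Subgroup G),
      ‖φ 0 - y‖ ≤ dist (f 0) x + (R₀ + C) := by
    intro y
    obtain ⟨g, hg⟩ := hC (f y)
    obtain ⟨k, -, hkF, hk⟩ := hR₀ g trivial ⟨f y, hrange ▸ Set.mem_range_self y, hg⟩
    obtain ⟨φ, hφ⟩ := exists_induced_isometry hf (hrange ▸ hkF)
    refine ⟨φ, ⟨k, trivial, hφ⟩, ?_⟩
    rw [← dist_eq_norm, ← hf.dist_eq, hφ]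
    have h1 := dist_triangle4 (k • f 0) (k • x) (g • x) (f y)
    rw [dist_smul, dist_comm (k • x), dist_comm (g • x) (f y)] at h1
    linarith
  obtain ⟨ν, -, hqc⟩ := exists_orbit_zero_quasiconvex hdisc hcob
    (inducedIsometries_mono f (le_top : H ≤ ⊤))
  obtain ⟨R₁, -, hR₁⟩ := exists_mem_stabilizer_dist_le hinv (hfin M) H hF
  set d := dist (f 0) x with hd
  refine ⟨(M + d) + (M + R₁ + d) + ν + d, ?_⟩
  rintro h hh P hP Q hQ hPx hQx
  obtain ⟨k, hkH, hkF, hk⟩ := hR₁ h hh ⟨Q, hQ, hQx⟩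
  rw [← hrange] at hP hQ
  obtain ⟨p, rfl⟩ := hP
  obtain ⟨q, rfl⟩ := hQ
  obtain ⟨φ, hφ⟩ := exists_induced_isometry hf (hrange ▸ hkF)
  refine ⟨_, _, isGeodesicSegment_lineMap hf p q, fun t ht => ?_⟩
  set s := t / dist p q with hs
  have hs01 : s ∈ Set.Icc (0 : ℝ) 1 :=
    ⟨div_nonneg ht.1 dist_nonneg, div_le_one_of_le₀ ht.2 dist_nonneg⟩
  obtain ⟨k', ⟨g, hg, hk'⟩, hk'ν⟩ := hqc φ ⟨k, hkH, hφ⟩ s hs01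
  refine ⟨g, hg, ?_⟩
  have hp : ‖p‖ ≤ M + d := by
    rw [← dist_zero_right, ← hf.dist_eq]
    have := dist_triangle_right (f p) (f 0) x
    linarith
  have hq : ‖q - φ 0‖ ≤ M + R₁ + d := by
    rw [← dist_eq_norm, ← hf.dist_eq, hφ]
    have := dist_triangle4 (f q) (h • x) (k • x) (k • f 0)
    rw [dist_smul, dist_comm x] at this
    linarith
  -- The segment from `p` to `q` is compared with the one from `0` to `φ 0`, whose ends are
  -- boundedly close to `p` and `q`.
  have hline : AffineMap.lineMap p q s - k' 0 =
      (1 - s) • p + s • (q - φ 0) + (s • φ 0 - k' 0) := by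
    rw [AffineMap.lineMap_apply_module, smul_sub]
    abel
  have h1 : ‖AffineMap.lineMap p q s - k' 0‖ ≤ (M + d) + (M + R₁ + d) + ν := by
    rw [hline]
    refine norm_add₃_le.trans (add_le_add (add_le_add ?_ ?_) hk'ν)
    · rw [norm_smul, Real.norm_of_nonneg (by linarith [hs01.2])]
      exact (mul_le_of_le_one_left (norm_nonneg _) (by linarith [hs01.1])).trans hp
    · rw [norm_smul, Real.norm_of_nonneg hs01.1]
      exact (mul_le_of_le_one_left (norm_nonneg _) hs01.2).trans hq
  rw [← dist_eq_norm, ← hf.dist_eq, hk'] at h1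
  have h2 := dist_triangle (f (AffineMap.lineMap p q s)) (g • f 0) (g • x)
  rw [dist_smul] at h2
  change dist (f (AffineMap.lineMap p q s)) (g • x) ≤ _
  linarith

/-- The bound of `exists_geodesic_near_orbit_of_mem_flat` can be chosen uniformly over an invariant
locally finite family of flats. -/
theorem exists_geodesic_near_orbit_of_mem_flats (hact : IsGeometricAction G X)
    [ProperSpace X] {𝓕 : Set (Set X)} (hflat : ∀ F ∈ 𝓕, IsFlat F)
    (hinv : ∀ g : G, ∀ F ∈ 𝓕, g • F ∈ 𝓕) {x : X}
    (hfin : ∀ M : ℝ, {F | F ∈ 𝓕 ∧ ∃ y ∈ F, dist y x ≤ M}.Finite) (H : Subgroup G) (M : ℝ) :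
    ∃ R : ℝ, 0 ≤ R ∧ ∀ F ∈ 𝓕, ∀ h₁ ∈ H, ∀ h₂ ∈ H, ∀ P ∈ F, ∀ Q ∈ F,
      dist P (h₁ • x) ≤ M → dist Q (h₂ • x) ≤ M →
      ∃ (γ : ℝ → X) (l : ℝ), IsGeodesicSegment γ l P Q ∧
        ∀ t ∈ Set.Icc 0 l, ∃ h ∈ H, dist (γ t) (h • x) ≤ R := by
  choose! R hR using fun F (hF : F ∈ 𝓕) =>
    exists_geodesic_near_orbit_of_mem_flat hact hflat hinv hfin H M hF
  obtain ⟨R', hR'0, hR'⟩ := (hfin M).exists_nonneg_upper_bound R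
  refine ⟨R', hR'0, fun F hF h₁ hh₁ h₂ hh₂ P hP Q hQ hPx hQx => ?_⟩
  -- Translating by `h₁⁻¹` brings the first endpoint near `x`, leaving finitely many flats over
  -- which to take the maximum.
  have hPx' : dist (h₁⁻¹ • P) x ≤ M := by rwa [← dist_smul h₁, smul_inv_smul]
  have hQx' : dist (h₁⁻¹ • Q) ((h₁⁻¹ * h₂) • x) ≤ M := by rwa [mul_smul, dist_smul]
  have hF' := hinv h₁⁻¹ F hF
  obtain ⟨γ, l, hγ, hnear⟩ := hR _ hF' _ (H.mul_mem (H.inv_mem hh₁) hh₂) _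
    (Set.smul_mem_smul_set hP) _ (Set.smul_mem_smul_set hQ) hPx' hQx'
  have hγ' := hγ.smul h₁
  rw [smul_inv_smul, smul_inv_smul] at hγ'
  refine ⟨_, l, hγ', fun t ht => ?_⟩
  obtain ⟨h, hh, hd⟩ := hnear t ht
  refine ⟨h₁ * h, H.mul_mem hh₁ hh, ?_⟩
  rw [mul_smul, dist_smul]
  exact hd.trans (hR' _ ⟨hF', _, Set.smul_mem_smul_set hP, hPx'⟩)

end FlatStabilizer

/-! ### Quasiconvexity versus undistortedness. -/

section Quasiconvex

open scoped Pointwise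

theorem Metric.exists_dist_lt_of_mem_cthickening {X : Type*} [MetricSpace X] {Y : Set X} {ν ν' : ℝ}
    {x : X} (hx : x ∈ Metric.cthickening ν Y) (h : ν < ν') (h0 : 0 < ν') :
    ∃ y ∈ Y, dist x y < ν' :=
  Metric.mem_thickening_iff.1 (Metric.cthickening_subset_thickening' h0 h Y hx)

theorem exists_partition_interval {t s : ℕ → ℝ} {n : ℕ} {x : ℝ} (h0 : t 0 ≤ x) (hn : x ≤ s n) :
    (∃ i ≤ n, x ∈ Set.Icc (t i) (s i)) ∨ ∃ i < n, x ∈ Set.Icc (s i) (t (i + 1)) := by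
  induction n with
  | zero => exact Or.inl ⟨0, le_rfl, h0, hn⟩
  | succ n ih =>
    rcases le_total (t (n + 1)) x with h | h
    · exact Or.inl ⟨n + 1, le_rfl, h, hn⟩
    · rcases le_total (s n) x with h' | h'
      · exact Or.inr ⟨n, n.lt_succ_self, h', h⟩
      · rcases ih h' with ⟨i, hi, hx⟩ | ⟨i, hi, hx⟩
        · exact Or.inl ⟨i, by omega, hx⟩
        · exact Or.inr ⟨i, by omega, hx⟩

theorem partition_mono {t s : ℕ → ℝ} {n : ℕ} (hts : ∀ i ≤ n, t i ≤ s i)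
    (hst : ∀ i < n, s i ≤ t (i + 1)) {i j : ℕ} (hij : i ≤ j) (hj : j ≤ n) :
    t i ≤ t j ∧ s i ≤ s j := by
  induction j, hij using Nat.le_induction with
  | base => exact ⟨le_rfl, le_rfl⟩
  | succ j hij ih =>
    obtain ⟨h1, h2⟩ := ih (by omega)
    have h3 := hts j (by omega)
    have h4 := hst j (by omega)
    have h5 := hts (j + 1) hj
    exact ⟨by linarith, by linarith⟩

variable {G X : Type*} [Group G] [MetricSpace X] [MulAction G X]

theorem IsGeodesicSegment.isQuasigeodesic {γ : ℝ → X} {l : ℝ} {x y : X}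
    (h : IsGeodesicSegment γ l x y) {lam ε : ℝ} (hlam : 1 ≤ lam) (hε : 0 ≤ ε) :
    IsQuasigeodesic lam ε γ l := by
  refine ⟨h.1, fun s t => ?_⟩
  have h1 : dist (γ s) (γ t) = dist s t := h.2.2.2 s s.2 t t.2
  have h2 : 0 ≤ dist s t := dist_nonneg
  simp only [h1]
  constructor
  · have : 1 / lam * dist s t ≤ 1 * dist s t :=
      mul_le_mul_of_nonneg_right ((div_le_one (by linarith)).2 hlam) h2
    linarith
  · nlinarith

variable [IsIsometricSMul G X]

/-- The orbit path of a geodesic word, as a quasigeodesic, when the orbit map is a quasi-isometric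
embedding. -/
theorem exists_quasigeodesic_orbit {T : Set G} (hT : IsFiniteGeneratingSet T) {x : X} {M A B : ℝ}
    (hM : ∀ g : G, dist x (g • x) ≤ M * wordLength T g) (hM0 : 0 ≤ M) (hA : 1 ≤ A)
    (hlow : ∀ g : G, (wordLength T g : ℝ) ≤ A * dist x (g • x) + B) (hB : 0 ≤ B) (g h : G) :
    ∃ (α : ℝ → X) (a : ℝ), IsQuasigeodesic (A + M) (M + 1 + B) α a ∧ α 0 = g • x ∧ α a = h • x ∧
      ∀ t, ∃ k : G, α t = k • x := by
  obtain ⟨p, hp0, hpn, hp⟩ := hT.exists_geodesic_word (g⁻¹ * h)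
  set n := wordLength T (g⁻¹ * h) with hn
  have key : ∀ s t : ℝ, 0 ≤ s → s ≤ t → t ≤ n →
      1 / (A + M) * dist s t - (M + 1 + B) ≤ dist ((g * p ⌊s⌋₊) • x) ((g * p ⌊t⌋₊) • x) ∧
      dist ((g * p ⌊s⌋₊) • x) ((g * p ⌊t⌋₊) • x) ≤ (A + M) * dist s t + (M + 1 + B) := by
    intro s t hs hst htn
    have hij : ⌊s⌋₊ ≤ ⌊t⌋₊ := Nat.floor_mono hst
    have hjn : ⌊t⌋₊ ≤ n := Nat.floor_le_of_le htn
    have hw := hp _ _ hij hjn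
    have hd : dist ((g * p ⌊s⌋₊) • x) ((g * p ⌊t⌋₊) • x) =
        dist x (((p ⌊s⌋₊)⁻¹ * p ⌊t⌋₊) • x) := by
      rw [mul_smul, mul_smul, dist_smul, ← dist_smul (p ⌊s⌋₊) x, ← mul_smul, mul_inv_cancel_left]
    have h1 := hM ((p ⌊s⌋₊)⁻¹ * p ⌊t⌋₊)
    have h2 := hlow ((p ⌊s⌋₊)⁻¹ * p ⌊t⌋₊)
    rw [hw, Nat.cast_sub hij, ← hd] at h1 h2
    have h3 := Nat.floor_le hs
    have h4 := Nat.floor_le (hs.trans hst)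
    have h5 := Nat.lt_floor_add_one s
    have h6 := Nat.lt_floor_add_one t
    have h7 : dist s t = t - s := by rw [dist_comm, Real.dist_eq, abs_of_nonneg (by linarith)]
    rw [h7]
    set D := dist ((g * p ⌊s⌋₊) • x) ((g * p ⌊t⌋₊) • x) with hD
    have hD0 : 0 ≤ D := dist_nonneg
    constructor
    -- Rounding down both times changes their difference by less than `1`, whence `t - s ≤ A * D + B
    -- + 1`.
    · have h8 : t - s ≤ (A + M) * (D + (M + 1 + B)) := by
        nlinarith [mul_nonneg hM0 hD0, mul_nonneg hM0 hM0, mul_nonneg hM0 hB]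
      have h9 : 1 / (A + M) * (t - s) ≤ D + (M + 1 + B) := by
        rw [one_div, inv_mul_le_iff₀ (by linarith)]
        exact h8
      linarith
    · have h8 : M * ((⌊t⌋₊ : ℝ) - ⌊s⌋₊) ≤ M * (t - s + 1) :=
        mul_le_mul_of_nonneg_left (by linarith) hM0
      nlinarith
  refine ⟨fun t => (g * p ⌊t⌋₊) • x, n, ⟨Nat.cast_nonneg _, ?_⟩, by simp [hp0], ?_,
    fun t => ⟨_, rfl⟩⟩
  · rintro ⟨s, hs⟩ ⟨t, ht⟩
    rcases le_total s t with hst | hst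
    · exact key s t hs.1 hst ht.2
    · have := key t s ht.1 hst hs.2
      rw [dist_comm t s, dist_comm ((g * p ⌊t⌋₊) • x)] at this
      exact this
  · simp [hpn]

instance (H : Subgroup G) : IsIsometricSMul H X := ⟨fun h => isometry_smul X (h : G)⟩

theorem inclusion_isQuasiIsometricEmbedding_of_isQuasiconvexSubgroup (hact : IsGeometricAction G X)
    [ProperSpace X] (hgeo : ∀ x y : X, ∃ (γ : ℝ → X) (l : ℝ), IsGeodesicSegment γ l x y)
    {H : Subgroup G} {S : Set G} {T : Set H} (hS : IsFiniteGeneratingSet S)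
    (hT : IsFiniteGeneratingSet T) (hq : IsQuasiconvexSubgroup H X) :
    InclusionIsQuasiIsometricEmbedding H T S := by
  obtain ⟨x, ν, hν, hq⟩ := hq
  obtain ⟨M, hM, hMS⟩ := hS.exists_dist_smul_le_mul_wordLength x
  obtain ⟨C, hC, hCT⟩ := hT.exists_wordLength_le_mul_dist (x := x)
    (fun R => Set.Finite.of_finite_image
      ((hact.finite_dist_smul_le x R).subset (by rintro _ ⟨h, hh, rfl⟩; exact hh))
      Subtype.val_injective.injOn)
    (ν := ν + 1) (by linarith) (fun h => by
      obtain ⟨γ, l, hγ⟩ := hgeo x (h • x)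
      refine ⟨γ, l, hγ, fun t ht => ?_⟩
      obtain ⟨_, ⟨h', rfl⟩, hd⟩ := Metric.exists_dist_lt_of_mem_cthickening
        (hq x (MulAction.mem_orbit_self x) _ (MulAction.mem_orbit x h) γ l hγ t ht)
        (lt_add_one ν) (by linarith)
      exact ⟨h', hd.le⟩)
  obtain ⟨M', hM', hMT⟩ := hT.1.exists_nonneg_upper_bound fun t => (wordLength S (t : G) : ℝ)
  obtain ⟨M'', hM'', hMT'⟩ := hT.1.exists_nonneg_upper_bound fun t => (wordLength S (t : G)⁻¹ : ℝ)
  have hup : ∀ h : H, (wordLength S (h : G) : ℝ) ≤ (M' + M'') * wordLength T h := by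
    intro h
    obtain ⟨l, hl, hlT, rfl⟩ := hT.exists_word h
    rw [← hl]
    clear hl
    induction l with
    | nil => simp [wordLength_one]
    | cons t l ih =>
      have h1 := ih fun y hy => hlT y (List.mem_cons_of_mem _ hy)
      have h2 : (wordLength S (t : G) : ℝ) ≤ M' + M'' := by
        rcases hlT t List.mem_cons_self with h | h
        · linarith [hMT t h]
        · have := hMT' _ h
          rw [Subgroup.coe_inv, inv_inv] at this
          linarith
      have h3 := hS.wordLength_mul_le (t : G) (l.prod : H)
      have h4 : (wordLength S ((t : G) * (l.prod : H)) : ℝ) ≤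
        wordLength S (t : G) + wordLength S ((l.prod : H) : G) := by exact_mod_cast h3
      rw [List.prod_cons, List.length_cons, Subgroup.coe_mul]
      push_cast at h1 h4 ⊢
      linarith
  -- The constants absorb `|h|_T ≤ C * M * |h|_S + 2 * C` and `|h|_S ≤ (M' + M'') * |h|_T`.
  refine ⟨1 + C * M + C + M' + M'', 2, ?_, by norm_num, fun a b => ?_⟩
  · have := mul_nonneg hC hM
    linarith
  have hCM := mul_nonneg hC hM
  have h1 := hup (a⁻¹ * b)
  have h2 := hCT (a⁻¹ * b)
  have h3 := hMS ((a⁻¹ * b : H) : G)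
  simp only [wordDist]
  have e : ((a⁻¹ * b : H) : G) = (a : G)⁻¹ * b := by simp
  rw [e] at h1 h3
  have h2' : (wordLength T (a⁻¹ * b) : ℝ) ≤ C * (dist x (((a : G)⁻¹ * b) • x) + 2) := by
    rw [← e]; exact h2
  set w := (wordLength T (a⁻¹ * b) : ℝ) with hw
  set v := (wordLength S ((a : G)⁻¹ * b) : ℝ) with hv
  have hw0 : 0 ≤ w := Nat.cast_nonneg _
  have hv0 : 0 ≤ v := Nat.cast_nonneg _
  have h3' := mul_le_mul_of_nonneg_left h3 hC
  constructor
  · rw [tsub_le_iff_right, one_div, inv_mul_le_iff₀ (by linarith)]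
    nlinarith [mul_nonneg hC hv0, mul_nonneg hM' hv0, mul_nonneg hM'' hv0]
  · nlinarith [mul_nonneg hC hw0, mul_nonneg hCM hw0]

theorem isQuasiconvexSubspace_orbit_of_inclusion_isQuasiIsometricEmbedding
    (hact : IsGeometricAction G X) [ProperSpace X] (hcat : IsCATZero X) (hflats : HasIsolatedFlats X)
    (hrftp : HasRelativeFellowTravellerProperty X) {H : Subgroup G} {S : Set G} {T : Set H}
    (hS : IsFiniteGeneratingSet S) (hT : IsFiniteGeneratingSet T)
    (hqi : InclusionIsQuasiIsometricEmbedding H T S) (x : X) :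
    IsQuasiconvexSubspace (MulAction.orbit H x) := by
  obtain ⟨lam, ε, hlam, hε, hqi⟩ := hqi
  obtain ⟨𝓕, hflat, ⟨B, hB⟩, ⟨ψ, hψ⟩, hisom⟩ := hflats
  have hinv : ∀ g : G, ∀ F ∈ 𝓕, g • F ∈ 𝓕 := fun g F hF => hisom (IsometryEquiv.constSMul g) F hF
  have hfin := finite_flats_near hflat hψ x
  obtain ⟨C, hC, hdense⟩ := hact.exists_dist_smul_le x
  obtain ⟨D, hD, hSD⟩ := hS.exists_wordLength_le_mul_dist (hact.finite_dist_smul_le x) hC (fun g => by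
    obtain ⟨γ, l, hγ⟩ := hcat.1 x (g • x)
    exact ⟨γ, l, hγ, fun t _ => hdense (γ t)⟩)
  obtain ⟨M, hM, hTM⟩ := hT.exists_dist_smul_le_mul_wordLength x
  have hlow : ∀ h : H, (wordLength T h : ℝ) ≤
      (1 + lam * D) * dist x (h • x) + lam * (2 * D + ε) := by
    intro h
    have h1 := (hqi 1 h).1
    simp only [wordDist, inv_one, one_mul, Subgroup.coe_one] at h1
    rw [tsub_le_iff_right, one_div, inv_mul_le_iff₀ (by linarith)] at h1
    have h2 := mul_le_mul_of_nonneg_left (hSD h) (by linarith : (0 : ℝ) ≤ lam)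
    have h3 : (0 : ℝ) ≤ dist x (h • x) := dist_nonneg
    rw [← Subgroup.smul_def] at h2
    nlinarith
  have hlD : 0 ≤ lam * D := by positivity
  have hlDε : 0 ≤ lam * (2 * D + ε) := by positivity
  obtain ⟨L, hL, hfellow⟩ := hrftp (1 + lam * D + M) (M + 1 + lam * (2 * D + ε)) (by linarith)
    (by linarith)
  -- `L + 1` passes from the quasigeodesic to a flat given by fellow travelling, and `max B 0 + 1`
  -- from there to a flat of `𝓕`; the added units turn closed thickenings into actual distances.
  obtain ⟨R, hR, hnear⟩ := exists_geodesic_near_orbit_of_mem_flats hact hflat hinv hfin H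
    (L + 1 + (max B 0 + 1))
  refine ⟨2 * (L + 1 + (L + 1 + (max B 0 + 1))) + R, by positivity, ?_⟩
  rintro _ ⟨g, rfl⟩ _ ⟨h, rfl⟩ γ l hγ u hu
  obtain ⟨α, a, hα, hα0, hαa, horb⟩ :=
    exists_quasigeodesic_orbit hT hTM hM (by linarith) hlow hlDε g h
  obtain ⟨n, F, hF, t, s, t', s', ⟨-, -, hts, hst⟩, ⟨ht'0, hs'n, hts', hst'⟩, hhaus, hthick⟩ :=
    hfellow α a γ l hα (hγ.isQuasigeodesic (by linarith) (by linarith)) (hα0.trans hγ.2.1.symm)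
      (hαa.trans hγ.2.2.1.symm)
  have hαγ : ∀ i ≤ n, ∀ v ∈ Set.Icc (t i) (s i), ∃ w ∈ Set.Icc (t' i) (s' i),
      dist (α v) (γ w) < L + 1 := by
    intro i hi v hv
    obtain ⟨_, ⟨w, hw, rfl⟩, hd⟩ := Metric.exists_edist_lt_of_hausdorffEDist_lt
      (Set.mem_image_of_mem α hv) ((hhaus i hi).trans_lt
        ((ENNReal.ofReal_lt_ofReal_iff (by linarith)).2 (lt_add_one L)))
    exact ⟨w, hw, by rwa [edist_dist, ENNReal.ofReal_lt_ofReal_iff (by linarith)] at hd⟩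
  have hγα : ∀ i ≤ n, ∀ w ∈ Set.Icc (t' i) (s' i), ∃ v, dist (γ w) (α v) < L + 1 := by
    intro i hi w hw
    have := hhaus i hi
    rw [Metric.hausdorffEDist_comm] at this
    obtain ⟨_, ⟨v, -, rfl⟩, hd⟩ := Metric.exists_edist_lt_of_hausdorffEDist_lt
      (Set.mem_image_of_mem γ hw) (this.trans_lt
        ((ENNReal.ofReal_lt_ofReal_iff (by linarith)).2 (lt_add_one L)))
    exact ⟨v, by rwa [edist_dist, ENNReal.ofReal_lt_ofReal_iff (by linarith)] at hd⟩
  have hB0 := le_max_right B 0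
  rcases exists_partition_interval (t := t') (s := s') (ht'0.trans_le hu.1) (hu.2.trans hs'n.ge) with
    ⟨i, hi, hui⟩ | ⟨i, hi, hui⟩
  · obtain ⟨v, hv⟩ := hγα i hi u hui
    obtain ⟨k, hk⟩ := horb v
    refine Metric.mem_cthickening_of_dist_le _ (k • x) _ _ (MulAction.mem_orbit x k) ?_
    rw [← hk]
    linarith
  · obtain ⟨F', hF', hFF'⟩ := hB (F ⟨i, hi⟩) (hF ⟨i, hi⟩)
    have hflat_near : ∀ v ∈ Set.Icc (s i) (t (i + 1)), ∃ P ∈ F',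
        dist P (α v) ≤ L + 1 + (max B 0 + 1) := by
      intro v hv
      obtain ⟨P, hP, hvP⟩ := Metric.exists_dist_lt_of_mem_cthickening
        ((hthick ⟨i, hi⟩).1 (Set.mem_image_of_mem α hv)) (lt_add_one L) (by linarith)
      obtain ⟨Q, hQ, hPQ⟩ := Metric.exists_dist_lt_of_mem_cthickening (hFF' hP)
        (show B < max B 0 + 1 by linarith [le_max_left B 0]) (by positivity)
      have := dist_triangle (α v) P Q
      exact ⟨Q, hQ, by rw [dist_comm]; linarith⟩
    have hsti := hst i hi
    obtain ⟨P, hP, hPα⟩ := hflat_near (s i) ⟨le_rfl, hsti⟩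
    obtain ⟨Q, hQ, hQα⟩ := hflat_near (t (i + 1)) ⟨hsti, le_rfl⟩
    obtain ⟨k₁, hk₁⟩ := horb (s i)
    obtain ⟨k₂, hk₂⟩ := horb (t (i + 1))
    obtain ⟨γ', l', hγ', hγ'H⟩ := hnear F' hF' k₁ k₁.2 k₂ k₂.2 P hP Q hQ (by
      rw [← Subgroup.smul_def, ← hk₁]; exact hPα) (by rw [← Subgroup.smul_def, ← hk₂]; exact hQα)
    -- The ends `s i` and `t (i + 1)` of the flat piece also belong to the adjacent Hausdorff-close
    -- pieces. Their partners `v₁`, `v₂` on `γ` therefore lie on either side of `u`, and the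
    -- subsegment between them contains `γ u`.
    obtain ⟨v₁, hv₁, hd₁⟩ := hαγ i hi.le (s i) ⟨hts i hi.le, le_rfl⟩
    obtain ⟨v₂, hv₂, hd₂⟩ := hαγ (i + 1) hi (t (i + 1)) ⟨le_rfl, hts (i + 1) hi⟩
    have hv₁u : v₁ ≤ u := hv₁.2.trans hui.1
    have huv₂ : u ≤ v₂ := hui.2.trans hv₂.1
    have hv₁0 : 0 ≤ v₁ := by
      have := (partition_mono hts' hst' (Nat.zero_le i) hi.le).1
      rw [ht'0] at this
      exact this.trans hv₁.1
    have hv₂l : v₂ ≤ l := by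
      have := (partition_mono hts' hst' hi le_rfl).2
      rw [hs'n] at this
      exact hv₂.2.trans this
    have hsub := hγ.subsegment hv₁0 (hv₁u.trans huv₂) hv₂l
    obtain ⟨τ, hτ, hτu⟩ : ∃ τ ∈ Set.Icc (0 : ℝ) 1, v₁ + τ * (v₂ - v₁) = u := by
      rcases (hv₁u.trans huv₂).eq_or_lt with h | h
      · exact ⟨0, by simp, by linarith⟩
      · have h' : 0 < v₂ - v₁ := by linarith
        refine ⟨(u - v₁) / (v₂ - v₁), ⟨div_nonneg (by linarith) h'.le,
          (div_le_one h').2 (by linarith)⟩, ?_⟩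
        rw [div_mul_cancel₀ _ h'.ne']
        ring
    have hd := hcat.dist_le_dist_add_dist hsub hγ' hτ
    simp only [hτu] at hd
    obtain ⟨k, hk, hkd⟩ := hγ'H (τ * l')
      ⟨mul_nonneg hτ.1 hγ'.1, mul_le_of_le_one_left hγ'.1 hτ.2⟩
    refine Metric.mem_cthickening_of_dist_le _ (k • x) _ _ ⟨⟨k, hk⟩, rfl⟩ ?_
    have h1 := dist_triangle (γ u) (γ' (τ * l')) (k • x)
    have h2 := dist_triangle (γ v₁) (α (s i)) P
    have h3 := dist_triangle (γ v₂) (α (t (i + 1))) Q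
    rw [dist_comm (γ v₁) (α (s i)), dist_comm (α (s i)) P] at h2
    rw [dist_comm (γ v₂) (α (t (i + 1))), dist_comm (α (t (i + 1))) Q] at h3
    linarith

omit [IsIsometricSMul G X] in
theorem isQuasiconvexSubgroup_iff [Nonempty X] (hact : IsGeometricAction G X) (hcat : IsCATZero X)
    (hflats : HasIsolatedFlats X) (hrftp : HasRelativeFellowTravellerProperty X) {H : Subgroup G}
    {S : Set G} {T : Set H} (hS : IsFiniteGeneratingSet S) (hT : IsFiniteGeneratingSet T) :
    IsQuasiconvexSubgroup H X ↔ InclusionIsQuasiIsometricEmbedding H T S := by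
  have := hact.isometric
  have := hact.properSpace hcat.1
  refine ⟨inclusion_isQuasiIsometricEmbedding_of_isQuasiconvexSubgroup hact hcat.1 hS hT, fun h => ?_⟩
  obtain ⟨x⟩ := ‹Nonempty X›
  exact ⟨x, isQuasiconvexSubspace_orbit_of_inclusion_isQuasiIsometricEmbedding hact hcat hflats hrftp
    hS hT h x⟩

omit [IsIsometricSMul G X] in
theorem IsGeometricAction.exists_isFiniteGeneratingSet [Nonempty X] (hact : IsGeometricAction G X)
    (hgeo : ∀ x y : X, ∃ (γ : ℝ → X) (l : ℝ), IsGeodesicSegment γ l x y) :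
    ∃ S : Set G, IsFiniteGeneratingSet S := by
  have := hact.isometric
  have := hact.properSpace hgeo
  obtain ⟨x⟩ := ‹Nonempty X›
  obtain ⟨C, hC, hdense⟩ := hact.exists_dist_smul_le x
  refine ⟨_, hact.finite_dist_smul_le x (2 * C + 1), closure_dist_smul_le_eq_top hC fun g => ?_⟩
  obtain ⟨γ, l, hγ⟩ := hgeo x (g • x)
  exact ⟨γ, l, hγ, fun t _ => hdense (γ t)⟩

end Quasiconvex

theorem theorem1p1 {G : Type*} [Group G] {X : Type*} [MetricSpace X] [Nonempty X] [MulAction G X]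
    (hact : IsGeometricAction G X) (hcat : IsCATZero X) (hflats : HasIsolatedFlats X)
    (hrftp : HasRelativeFellowTravellerProperty X) (H : Subgroup G) (hH : H.FG) :
    Group.FG G ∧
    (∀ (S : Set G) (T : Set H), IsFiniteGeneratingSet S → IsFiniteGeneratingSet T →
      (IsQuasiconvexSubgroup H X ↔ InclusionIsQuasiIsometricEmbedding H T S)) ∧
    ∀ (Y : Type*) [MetricSpace Y] [Nonempty Y] [MulAction G Y],
      IsGeometricAction G Y → IsCATZero Y → HasIsolatedFlats Y →
      HasRelativeFellowTravellerProperty Y →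
      (IsQuasiconvexSubgroup H X ↔ IsQuasiconvexSubgroup H Y) := by
  
  obtain ⟨S₀, hS₀⟩ := hact.exists_isFiniteGeneratingSet hcat.1
  refine ⟨Group.fg_iff.2 ⟨S₀, hS₀.2, hS₀.1⟩,
    fun S T hS hT => isQuasiconvexSubgroup_iff hact hcat hflats hrftp hS hT, ?_⟩
  intro Y _ _ _ hactY hcatY hflatsY hrftpY
  obtain ⟨T₀, hT₀, hT₀fin⟩ := Group.fg_iff.1 ((Group.fg_iff_subgroup_fg H).2 hH)
  -- Undistortedness for fixed word metrics does not refer to the action, so it mediates between the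
  -- two spaces.
  rw [isQuasiconvexSubgroup_iff hact hcat hflats hrftp hS₀ ⟨hT₀fin, hT₀⟩,
    isQuasiconvexSubgroup_iff hactY hcatY hflatsY hrftpY hS₀ ⟨hT₀fin, hT₀⟩]
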